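/- Let $M\ge 1$ be an integer and $p\in[0,1]$. Consider the following discrete-time system of $M$ stations numbered $1,\dots,M$, each with an infinite red queue and an infinite green queue. Put $i(t)=((t-1)\bmod M)+1$ for $t\ge 0$. Let $R_i^t$ and $G_i^t$ be the numbers of red and green messages at station $i$ at the beginning of slot $t$. In slot $t$: * if the red queue of station $i(t)$ is non-empty, one red message leaves it; no other red message leaves the system; * every station which has a green message, and which is not transmitting a red message in this slot, attempts to transmit a green message with probability $p$, independently of everything else. If exactly one station attempts, one green message leaves that station; otherwise no green message leaves the system; * $\xi^t$ red and $\eta^t$ green messages arrive and are added to the queues (they are counted in $R^{t+1},G^{t+1}$); each of them joins one of the $M$ stations, chosen uniformly. The sequences $(\xi^t)_{t\ge0}$ and $(\eta^t)_{t\ge 0}$ are i.i.d. sequences of non-negative integer-valued random variables with finite means $\lambda_R=\mathbf E\xi^0$ and $\lambda_G=\mathbf E\eta^0$; these two sequences, the choices of stations and the decisions to attempt a transmission are all mutually independent. Define the relabelled process by $$\check R_k^t=R^t_{i(t+k-1)},\qquad \check G_k^t=G^t_{i(t+k-1)},\qquad k=1,\dots,M,\ t\ge 0,$$ so that the first coordinate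 always belongs to the currently scheduled station. Assume $\lambda_R<1$ and $$\lambda_G<(1-\lambda_R)p \quad\text{if } M=1,\qquad \lambda_G<\lambda_R(M-1)p(1-p)^{M-2}+(1-\lambda_R)Mp(1-p)^{M-1}\quad\text{if } M>1$$ (with $0^0=1$). Then $(\check R,\check G)=\{(\check R_1^t,\dots,\check R_M^t,\check G_1^t,\dots,\check G_M^t)\}_{t\ge0}$ is a time-homogeneous Markov chain on $\mathbb Z_+^{2M}$, with a transition kernel that does not depend on the initial state, and it is Harris ergodic: it has a unique stationary distribution $\pi$, and for every initial value $x$, $$\sup_{A\subseteq \mathbb Z_+^{2M}}\bigl|\mathbf P_x\bigl((\check R^t,\check G^t)\in A\bigr)-\pi(A)\bigr|\to0\qquad(t\to\infty).$$ -/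

import Mathlib

open MeasureTheory ProbabilityTheory Filter Topology

/-- The sources of randomness of the network with `M` stations. -/
inductive Source (M : ℕ) where
  | red (t : ℕ)
  | green (t : ℕ)
  | redNode (t k : ℕ)
  | greenNode (t k : ℕ)
  | coin (t : ℕ) (i : Fin M)

/-- The random inputs of the network with `M` stations (numbered `0, …, M - 1`):
* `red t`, `green t`: the total numbers of red, respectively green, messages that arrive in slot `t`;
* `redNode t k`, `greenNode t k`: the station to which the `k`-th red, respectively green, message
  arriving in slot `t` is assigned (`k = 0, 1, …`; only the first `red t`, respectively `green t`,
  assignments are used);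
* `coin t i`: whether station `i` decides to attempt a green transmission in slot `t`. -/
structure Inputs (M : ℕ) (Ω : Type*) where
  red : ℕ → Ω → ℕ
  green : ℕ → Ω → ℕ
  redNode : ℕ → ℕ → Ω → Fin M
  greenNode : ℕ → ℕ → Ω → Fin M
  coin : ℕ → Fin M → Ω → Bool

namespace Inputs

variable {M : ℕ} {Ω : Type*}

/-- The σ-algebra generated by one source of randomness. -/
@[reducible] def sigma (I : Inputs M Ω) : Source M → MeasurableSpace Ω
  | .red t => MeasurableSpace.comap (I.red t) ⊤
  | .green t => MeasurableSpace.comap (I.green t) ⊤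
  | .redNode t k => MeasurableSpace.comap (I.redNode t k) ⊤
  | .greenNode t k => MeasurableSpace.comap (I.greenNode t k) ⊤
  | .coin t i => MeasurableSpace.comap (I.coin t i) ⊤

/-- The probabilistic assumptions on the inputs: all sources are mutually independent, the numbers
of red (green) arrivals are identically distributed over the slots with finite mean `lamR` (`lamG`),
every message is assigned to a uniformly chosen station, and every decision to attempt a
transmission is positive with probability `p`. -/
structure Satisfies [MeasurableSpace Ω] (I : Inputs M Ω) (μ : Measure Ω) (lamR lamG p : ℝ) :
    Prop where
  measurable_red : ∀ t, Measurable (I.red t)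
  measurable_green : ∀ t, Measurable (I.green t)
  measurable_redNode : ∀ t k, Measurable (I.redNode t k)
  measurable_greenNode : ∀ t k, Measurable (I.greenNode t k)
  measurable_coin : ∀ t i, Measurable (I.coin t i)
  indep : iIndep I.sigma μ
  identDistrib_red : ∀ t, IdentDistrib (I.red t) (I.red 0) μ μ
  identDistrib_green : ∀ t, IdentDistrib (I.green t) (I.green 0) μ μ
  integrable_red : Integrable (fun ω => (I.red 0 ω : ℝ)) μ
  integrable_green : Integrable (fun ω => (I.green 0 ω : ℝ)) μ
  mean_red : ∫ ω, (I.red 0 ω : ℝ) ∂μ = lamR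
  mean_green : ∫ ω, (I.green 0 ω : ℝ) ∂μ = lamG
  redNode_uniform : ∀ t k i, μ {ω | I.redNode t k ω = i} = (M : ENNReal)⁻¹
  greenNode_uniform : ∀ t k i, μ {ω | I.greenNode t k ω = i} = (M : ENNReal)⁻¹
  coin_prob : ∀ t i, μ {ω | I.coin t i ω = true} = ENNReal.ofReal p

/-- The number of red messages that arrive at station `i` in slot `t`. -/
def redAt (I : Inputs M Ω) (t : ℕ) (i : Fin M) (ω : Ω) : ℕ :=
  ((Finset.range (I.red t ω)).filter fun k => I.redNode t k ω = i).card

/-- The number of green messages that arrive at station `i` in slot `t`. -/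
def greenAt (I : Inputs M Ω) (t : ℕ) (i : Fin M) (ω : Ω) : ℕ :=
  ((Finset.range (I.green t ω)).filter fun k => I.greenNode t k ω = i).card

end Inputs

/-- A state: the numbers of red messages and of green messages, station by station. -/
abbrev QState (M : ℕ) : Type := (Fin M → ℕ) × (Fin M → ℕ)

/-- The station scheduled in slot `t`, namely `(t - 1) mod M` in the numbering `0, …, M - 1`
(so it is `M - 1` for `t = 0`). -/
def scheduled (M : ℕ) [NeZero M] (t : ℕ) : Fin M := Fin.ofNat M (t + (M - 1))

/-- Station `i` attempts a green transmission, when station `s` is scheduled, the state is `z` and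
the decisions are `c`: it has a green message, it decides to transmit, and it is not busy with
the transmission of a red message. -/
def Attempts {M : ℕ} (s : Fin M) (z : QState M) (c : Fin M → Bool) (i : Fin M) : Prop :=
  0 < z.2 i ∧ c i = true ∧ ¬ (i = s ∧ 0 < z.1 i)

/-- The green transmission of station `i` succeeds: `i` is the only station that attempts one. -/
def Succeeds {M : ℕ} (s : Fin M) (z : QState M) (c : Fin M → Bool) (i : Fin M) : Prop :=
  Attempts s z c i ∧ ∀ j, j ≠ i → ¬ Attempts s z c j

open Classical in
/-- One slot: station `s` is scheduled, `c` are the decisions, `a` and `b` are the numbers of new red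
and green messages at the stations. The natural-number subtractions are exact, since a message
leaves only a non-empty queue. -/
noncomputable def slotStep {M : ℕ} (s : Fin M) (c : Fin M → Bool) (a b : Fin M → ℕ)
    (z : QState M) : QState M :=
  (fun i => z.1 i - (if i = s ∧ 0 < z.1 i then 1 else 0) + a i,
   fun i => z.2 i - (if Succeeds s z c i then 1 else 0) + b i)

/-- The queue lengths `(R^t, G^t)` at the beginning of slot `t`, started from `z` at time `0`. -/
noncomputable def queues {M : ℕ} [NeZero M] {Ω : Type*} (I : Inputs M Ω) (z : QState M) :
    ℕ → Ω → QState M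
  | 0, _ => z
  | t + 1, ω =>
      slotStep (scheduled M t) (fun i => I.coin t i ω) (fun i => I.redAt t i ω)
        (fun i => I.greenAt t i ω) (queues I z t ω)

/-- Cyclic relabelling at time `t`: the `k`-th new coordinate (`k = 0, …, M - 1`) is the coordinate
of the station scheduled in slot `t + k`. -/
def relabel {M : ℕ} [NeZero M] (t : ℕ) (z : QState M) : QState M :=
  (fun k => z.1 (scheduled M (t + k)), fun k => z.2 (scheduled M (t + k)))

/-- `X` is a time-homogeneous Markov chain with transition kernel `K` on a countable space. -/
def IsMarkovChain {Ω S : Type*} [MeasurableSpace Ω] [MeasurableSpace S] [Countable S]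
    [MeasurableSingletonClass S] (μ : Measure Ω) (X : ℕ → Ω → S) (K : Kernel S S) : Prop :=
  (∀ t, Measurable (X t)) ∧
  ∀ (t : ℕ) (s : ℕ → S),
    μ {ω | ∀ k ≤ t + 1, X k ω = s k} = μ {ω | ∀ k ≤ t, X k ω = s k} * K (s t) {s (t + 1)}

/-- Harris ergodicity: there is a unique stationary distribution, and from every initial value the
`t`-step distributions `(K ^ t) x` (powers with respect to composition of kernels) converge to it in total variation. -/
def IsHarrisErgodic {S : Type*} [MeasurableSpace S] (K : Kernel S S) : Prop :=
  ∃ π : Measure S, IsProbabilityMeasure π ∧ K.Invariant π ∧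
    (∀ π' : Measure S, IsProbabilityMeasure π' → K.Invariant π' → π' = π) ∧
    ∀ x : S, Tendsto
      (fun t => ⨆ A : {A : Set S // MeasurableSet A}, |((K ^ t) x).real A.1 - π.real A.1|)
      atTop (𝓝 0)

/-! The relabelled process is driven by independent identically distributed slot inputs, so the
theorem reduces to general facts about chains on a countable space and to estimates on a single
slot.

Suppose that the time-averaged laws are tight, with the same finite sets for all initial states, and
that some state `o` with positive holding probability is accessible from everywhere. Two independent
copies are then simultaneously in a finite set at some time with probability bounded below, hence
meet at `o` with probability at least some `c > 0` that does not depend on where they start. The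
supremum `s` of the asymptotic total variation distances satisfies `s ≤ s - s * c`, so it vanishes
(`limDist_eq_zero`). Limits of the occupation measures give the stationary law
(`invariant_limMeasure`).

Tightness comes from a Lyapunov function. The red workload `M R_k + k` has mean drift `lamR - 1 <
0`, except at an idle scheduled station, where the workload is zero. For the green queues put `α =
p(1-p)^(M-1)`, `β = p(1-p)^(M-2)` and `γ = β - α`. A station with green messages succeeds with
probability at least `α` if the scheduled station has no red message, at least `β` if another
station is sending red, and `0` if it is sending red itself. Adding `β R_k - γ ∑ R_j` to `G_k`
levels these three cases to `α`, and the drift becomes at most `-δ`, where `M δ` is the gap in the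
stability condition (`SlotLaw.integral_greenIncr_le`). The error at stations without green messages
is paid for by the red drift.

Only first moments are available, so squares are replaced by `huber L`, quadratic up to `L` and
linear beyond: the second-order error is `o(L)`, while the drift outside a finite set is of order
`-L`.

The accessible state is the empty one. Only `p = 1` needs care there, since collisions are then
certain and must be broken up by a red arrival. -/

set_option linter.unusedSectionVars false

/-! ### Loss of memory by independent coupling -/

section Ergodicity

open scoped ENNReal

variable {S : Type*} [MeasurableSpace S]

/-- The total variation distance between the `n`-step distributions from `x` and `y`. -/
noncomputable def kernelDist (K : Kernel S S) (n : ℕ) (x y : S) : ℝ≥0∞ :=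
  ⨆ A : {A : Set S // MeasurableSet A}, ((K ^ n) x A.1 - (K ^ n) y A.1)

/-- The occupation measures of the chain are tight, uniformly in the initial state. -/
def CesaroTight (K : Kernel S S) : Prop :=
  ∀ ε : ℝ≥0∞, 0 < ε → ∃ F : Set S, F.Finite ∧ ∀ x, ∀ᶠ n : ℕ in atTop,
    ∑ t ∈ Finset.range n, (K ^ t) x Fᶜ ≤ ε * n

instance isMarkovKernel_pow (K : Kernel S S) [IsMarkovKernel K] (n : ℕ) :
    IsMarkovKernel (K ^ n) := by
  induction n with
  | zero => rw [pow_zero]; exact inferInstanceAs (IsMarkovKernel Kernel.id)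
  | succ n ih => rw [pow_succ]; exact inferInstanceAs (IsMarkovKernel (_ ∘ₖ _))

variable {K : Kernel S S}

lemma kernelDist_self (n : ℕ) (x : S) : kernelDist K n x x = 0 := by
  simp [kernelDist]

lemma pow_apply_le_add_kernelDist (n : ℕ) (x y : S) {A : Set S} (hA : MeasurableSet A) :
    (K ^ n) x A ≤ (K ^ n) y A + kernelDist K n x y := by
  rw [← tsub_le_iff_left]
  exact le_iSup (fun A : {A : Set S // MeasurableSet A} => (K ^ n) x A.1 - (K ^ n) y A.1) ⟨A, hA⟩

/-- The asymptotic distance between the distributions started from `x` and `y`. -/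
noncomputable def limDist (K : Kernel S S) (x y : S) : ℝ≥0∞ :=
  limsup (fun n => kernelDist K n x y) atTop

lemma tendsto_kernelDist (x y : S) (h : limDist K x y = 0) :
    Tendsto (fun n => kernelDist K n x y) atTop (𝓝 0) :=
  tendsto_of_le_liminf_of_limsup_le zero_le h.le

lemma mul_le_pow_add [Countable S] [MeasurableSingletonClass S]
    (m n : ℕ) (x y : S) (A : Set S) :
    (K ^ m) x {y} * (K ^ n) y A ≤ (K ^ (m + n)) x A := by
  rw [Kernel.pow_add_apply_eq_lintegral K m n x (Set.to_countable A).measurableSet]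
  calc (K ^ m) x {y} * (K ^ n) y A = ∫⁻ z in {y}, (K ^ n) z A ∂((K ^ m) x) := by
        rw [lintegral_singleton, mul_comm]
    _ ≤ _ := setLIntegral_le_lintegral _ _

/-- Waiting at `o` costs only a positive factor per step. This plays the role of aperiodicity:
different hitting times can be replaced by a common one. -/
lemma pow_pos_of_le [Countable S] [MeasurableSingletonClass S]
    {o x : S} (hloop : 0 < K o {o}) {m n : ℕ} (hmn : m ≤ n)
    (h : 0 < (K ^ m) x {o}) : 0 < (K ^ n) x {o} := by
  induction n, hmn using Nat.le_induction with
  | base => exact h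
  | succ n _ ih =>
    refine lt_of_lt_of_le ?_ (mul_le_pow_add n 1 x o {o})
    rw [pow_one]
    exact ENNReal.mul_pos ih.ne' hloop.ne'

variable [IsMarkovKernel K]

lemma kernelDist_le_one (n : ℕ) (x y : S) : kernelDist K n x y ≤ 1 :=
  iSup_le fun _ => tsub_le_self.trans prob_le_one

lemma limDist_le_one (x y : S) : limDist K x y ≤ 1 :=
  (limsup_le_limsup (Eventually.of_forall fun n => kernelDist_le_one n x y)).trans
    (by simp)

variable [Countable S] [MeasurableSingletonClass S]

/-- The two chains are run independently for `m` steps and compared from the states they have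
reached. -/
lemma kernelDist_add_le (m n : ℕ) (x y : S) :
    kernelDist K (m + n) x y
      ≤ ∫⁻ x', ∫⁻ y', kernelDist K n x' y' ∂((K ^ m) y) ∂((K ^ m) x) := by
  refine iSup_le fun ⟨A, hA⟩ => ?_
  rw [tsub_le_iff_left]
  dsimp only
  rw [Kernel.pow_add_apply_eq_lintegral K m n x hA, Kernel.pow_add_apply_eq_lintegral K m n y hA]
  calc ∫⁻ x', (K ^ n) x' A ∂((K ^ m) x)
      = ∫⁻ x', ∫⁻ _, (K ^ n) x' A ∂((K ^ m) y) ∂((K ^ m) x) := by simp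
    _ ≤ ∫⁻ x', ∫⁻ y', ((K ^ n) y' A + kernelDist K n x' y') ∂((K ^ m) y) ∂((K ^ m) x) :=
        lintegral_mono fun x' => lintegral_mono fun y' => pow_apply_le_add_kernelDist n x' y' hA
    _ = _ := by
        simp_rw [lintegral_add_left (measurable_of_countable _)]
        simp

/-- Reverse Fatou, applied twice with the dominating function `1`, passes the limsup through the
coupling bound. -/
lemma limDist_le_lintegral (m : ℕ) (x y : S) :
    limDist K x y ≤ ∫⁻ x', ∫⁻ y', limDist K x' y' ∂((K ^ m) y) ∂((K ^ m) x) := by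
  calc limDist K x y = limsup (fun n => kernelDist K (n + m) x y) atTop :=
        (limsup_nat_add (fun n => kernelDist K n x y) m).symm
    _ ≤ limsup (fun n => ∫⁻ x', ∫⁻ y', kernelDist K n x' y' ∂((K ^ m) y) ∂((K ^ m) x)) atTop :=
        limsup_le_limsup (Eventually.of_forall fun n => by
          dsimp only; rw [add_comm]; exact kernelDist_add_le m n x y)
    _ ≤ ∫⁻ x', limsup (fun n => ∫⁻ y', kernelDist K n x' y' ∂((K ^ m) y)) atTop ∂((K ^ m) x) := by
        refine limsup_lintegral_le 1 (fun n => measurable_of_countable _)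
          (fun n => Eventually.of_forall fun x' => ?_) (by simp)
        calc ∫⁻ y', kernelDist K n x' y' ∂((K ^ m) y) ≤ ∫⁻ _, 1 ∂((K ^ m) y) :=
              lintegral_mono fun y' => kernelDist_le_one n x' y'
          _ = 1 := by simp
    _ ≤ _ := lintegral_mono fun x' =>
        limsup_lintegral_le 1 (fun n => measurable_of_countable _)
          (fun n => Eventually.of_forall fun y' => kernelDist_le_one n x' y') (by simp)

/-- A pair that has met at `o` contributes nothing to the coupling bound, and every other pair
contributes at most the supremum `s`. Hence `s ≤ s - s * c` with `s` finite, which forces `s = 0`.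
-/
lemma limDist_eq_zero {o : S} {c : ℝ≥0∞} (hc : 0 < c)
    (h : ∀ x y, ∃ m, c ≤ (K ^ m) x {o} * (K ^ m) y {o}) (x y : S) : limDist K x y = 0 := by
  set s : ℝ≥0∞ := ⨆ x, ⨆ y, limDist K x y with hs
  have hle : ∀ x y, limDist K x y ≤ s := fun x y =>
    (le_iSup (limDist K x) y).trans (le_iSup (fun x => ⨆ y, limDist K x y) x)
  have hs1 : s ≤ 1 := iSup_le fun x => iSup_le fun y => limDist_le_one x y
  have hoo : limDist K o o = 0 := by simp [limDist, kernelDist_self]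
  have key : ∀ x y, limDist K x y ≤ s - s * c := by
    intro x y
    obtain ⟨m, hm⟩ := h x y
    have hfin : s * c ≠ ∞ := by
      refine ENNReal.mul_ne_top (hs1.trans_lt ENNReal.one_lt_top).ne
        (ne_top_of_le_ne_top ?_ hm)
      exact ENNReal.mul_ne_top (measure_ne_top _ _) (measure_ne_top _ _)
    refine ENNReal.le_sub_of_add_le_right hfin ?_
    calc limDist K x y + s * c
        ≤ ∫⁻ x', ∫⁻ y', limDist K x' y' ∂((K ^ m) y) ∂((K ^ m) x)
          + ∫⁻ x', ∫⁻ y', s * (({o} : Set S).indicator 1 x' * ({o} : Set S).indicator 1 y')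
            ∂((K ^ m) y) ∂((K ^ m) x) := by
          refine add_le_add (limDist_le_lintegral m x y) ?_
          simp_rw [lintegral_const_mul _ (measurable_of_countable _)]
          rw [lintegral_mul_const _ (measurable_of_countable _)]
          rw [lintegral_indicator_one (measurableSet_singleton o),
            lintegral_indicator_one (measurableSet_singleton o)]
          gcongr
      _ = ∫⁻ x', ∫⁻ y', (limDist K x' y'
            + s * (({o} : Set S).indicator 1 x' * ({o} : Set S).indicator 1 y'))
            ∂((K ^ m) y) ∂((K ^ m) x) := by
          simp_rw [lintegral_add_left (measurable_of_countable _)]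
      _ ≤ ∫⁻ _, ∫⁻ _, s ∂((K ^ m) y) ∂((K ^ m) x) := by
          refine lintegral_mono fun x' => lintegral_mono fun y' => ?_
          dsimp only
          by_cases hx : x' = o
          · by_cases hy : y' = o
            · subst hx; subst hy; simp [hoo]
            · simp [hy, hle]
          · simp [hx, hle]
      _ = s := by simp
  have h2 : s ≤ s - s * c := iSup_le fun x => iSup_le fun y => key x y
  have h3 : s = 0 := by
    by_contra h0
    have : s - s * c < s := ENNReal.sub_lt_self (hs1.trans_lt ENNReal.one_lt_top).ne h0
      (mul_ne_zero h0 hc.ne')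
    exact absurd h2 (not_le.mpr this)
  exact le_antisymm ((hle x y).trans h3.le) zero_le

lemma exists_uniform_mul_le {o : S} (hloop : 0 < K o {o}) (hreach : ∀ x, ∃ n, 0 < (K ^ n) x {o})
    (htight : CesaroTight K) :
    ∃ c : ℝ≥0∞, 0 < c ∧ ∀ x y, ∃ m, c ≤ (K ^ m) x {o} * (K ^ m) y {o} := by
  -- With `1 / 8` for each of two starting points, the two masses outside `F` sum to at most `1 / 4`
  -- on average, so at some time their sum is at most `1 / 2`.
  obtain ⟨F, hF, hFt⟩ := htight (1 / 8) (by simp)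
  choose n hn using hreach
  obtain ⟨N, hN⟩ : ∃ N, ∀ x ∈ F, n x ≤ N := by
    obtain ⟨N, hN⟩ := (hF.image n).bddAbove
    exact ⟨N, fun x hx => hN ⟨x, hx, rfl⟩⟩
  have hpos : ∀ x ∈ F, 0 < (K ^ N) x {o} := fun x hx => pow_pos_of_le hloop (hN x hx) (hn x)
  obtain ⟨d, hd, hdF⟩ : ∃ d : ℝ≥0∞, 0 < d ∧ ∀ x ∈ F, d ≤ (K ^ N) x {o} := by
    refine ⟨hF.toFinset.inf fun x => (K ^ N) x {o}, ?_, fun x hx =>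
      Finset.inf_le (f := fun x => (K ^ N) x {o}) (hF.mem_toFinset.mpr hx)⟩
    rw [Finset.lt_inf_iff (by simp)]
    exact fun x hx => hpos x (hF.mem_toFinset.mp hx)
  have hFm : MeasurableSet F := (Set.to_countable F).measurableSet
  -- From any point of the finite set `F`, the state `o` carries mass at least `d` after exactly `N`
  -- steps.
  have hstep : ∀ t x, (K ^ t) x Fᶜ ≤ 1 / 2 → d * (1 / 2) ≤ (K ^ (t + N)) x {o} := by
    intro t x hx
    have h1 : 1 / 2 ≤ (K ^ t) x F := by
      have h2 := prob_add_prob_compl (μ := (K ^ t) x) hFm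
      by_contra hlt
      rw [not_le] at hlt
      have h3 : (K ^ t) x F + (K ^ t) x Fᶜ < 1 / 2 + 1 / 2 :=
        ENNReal.add_lt_add_of_lt_of_le (measure_ne_top _ _) hlt hx
      rw [h2, ENNReal.add_halves] at h3
      exact lt_irrefl _ h3
    rw [Kernel.pow_add_apply_eq_lintegral K t N x (measurableSet_singleton o)]
    calc d * (1 / 2) ≤ d * (K ^ t) x F := by gcongr
      _ = ∫⁻ _ in F, d ∂((K ^ t) x) := by rw [setLIntegral_const]
      _ ≤ ∫⁻ b in F, (K ^ N) b {o} ∂((K ^ t) x) :=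
          setLIntegral_mono (measurable_of_countable _) hdF
      _ ≤ _ := setLIntegral_le_lintegral _ _
  refine ⟨d * (1 / 2) * (d * (1 / 2)), ?_, fun x y => ?_⟩
  · have : 0 < d * (1 / 2) := ENNReal.mul_pos hd.ne' (by simp)
    exact ENNReal.mul_pos this.ne' this.ne'
  · obtain ⟨k, ⟨hx, hy⟩, hk⟩ := (((hFt x).and (hFt y)).and (eventually_ge_atTop 1)).exists
    obtain ⟨t, -, ht⟩ : ∃ t ∈ Finset.range k, (K ^ t) x Fᶜ + (K ^ t) y Fᶜ ≤ 1 / 2 := by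
      by_contra! hlt
      have h1 : (k : ℝ≥0∞) * (1 / 2) ≤ k * (1 / 4) := by
        calc (k : ℝ≥0∞) * (1 / 2) = ∑ t ∈ Finset.range k, (1 / 2 : ℝ≥0∞) := by simp
          _ ≤ ∑ t ∈ Finset.range k, ((K ^ t) x Fᶜ + (K ^ t) y Fᶜ) :=
              Finset.sum_le_sum fun t ht => (hlt t ht).le
          _ ≤ 1 / 8 * k + 1 / 8 * k := by rw [Finset.sum_add_distrib]; exact add_le_add hx hy
          _ = k * (1 / 4) := by
              rw [← add_mul, mul_comm, ← ENNReal.add_div,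
                show (4 : ℝ≥0∞) = ((4 : NNReal) : ℝ≥0∞) by simp,
                show (8 : ℝ≥0∞) = ((8 : NNReal) : ℝ≥0∞) by simp]
              congr 1
              rw [show (1 + 1 : ℝ≥0∞) = ((2 : NNReal) : ℝ≥0∞) by norm_num,
                show (1 : ℝ≥0∞) = ((1 : NNReal) : ℝ≥0∞) by norm_num,
                ← ENNReal.coe_div (by simp), ← ENNReal.coe_div (by simp)]
              congr 1
              norm_num
      rw [ENNReal.mul_le_mul_iff_right (by simp; omega) (by simp)] at h1
      simp only [one_div] at h1
      rw [ENNReal.inv_le_inv] at h1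
      norm_num at h1
    exact ⟨t + N, mul_le_mul' (hstep t x (le_self_add.trans ht))
      (hstep t y (le_add_self.trans ht))⟩

end Ergodicity

/-! ### The stationary law as a limit of occupation measures -/

section Stationary

open scoped ENNReal

variable {S : Type*} [MeasurableSpace S]

/-- The normalized occupation measure of `A` during the first `n` steps from `x`. -/
noncomputable def occupation (K : Kernel S S) (x : S) (n : ℕ) (A : Set S) : ℝ≥0∞ :=
  (∑ t ∈ Finset.range n, (K ^ t) x A) / n

/-- A limit of the normalized occupation measures of the points along an ultrafilter. -/
noncomputable def limOccupation (K : Kernel S S) (x y : S) : ℝ≥0∞ :=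
  ((hyperfilter ℕ : Ultrafilter ℕ).map fun n => occupation K x n {y}).lim

/-- Compactness of `ℝ≥0∞`: an ultrafilter gives convergence at all points simultaneously, without
extracting subsequences. -/
lemma tendsto_limOccupation (K : Kernel S S) (x y : S) :
    Tendsto (fun n => occupation K x n {y}) (hyperfilter ℕ) (𝓝 (limOccupation K x y)) :=
  Ultrafilter.le_nhds_lim _

lemma hyperfilter_le_atTop : (hyperfilter ℕ : Filter ℕ) ≤ atTop :=
  Nat.cofinite_eq_atTop ▸ hyperfilter_le_cofinite

variable [Countable S] [MeasurableSingletonClass S] {K : Kernel S S}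

lemma occupation_finset (x : S) (n : ℕ) (F : Finset S) :
    occupation K x n F = ∑ y ∈ F, occupation K x n {y} := by
  simp only [occupation, ENNReal.div_eq_inv_mul, ← Finset.mul_sum]
  congr 1
  rw [Finset.sum_comm]
  exact Finset.sum_congr rfl fun t _ => (sum_measure_singleton).symm

variable [IsMarkovKernel K]

lemma occupation_le_one (x : S) (n : ℕ) (A : Set S) : occupation K x n A ≤ 1 := by
  refine ENNReal.div_le_of_le_mul ?_
  calc ∑ t ∈ Finset.range n, (K ^ t) x A ≤ ∑ t ∈ Finset.range n, 1 :=
        Finset.sum_le_sum fun t _ => prob_le_one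
    _ = 1 * n := by simp

lemma one_le_occupation_add {x : S} {n : ℕ} (hn : n ≠ 0) {A : Set S} {ε : ℝ≥0∞}
    (h : ∑ t ∈ Finset.range n, (K ^ t) x Aᶜ ≤ ε * n) : 1 ≤ occupation K x n A + ε := by
  have h1 : (n : ℝ≥0∞) = ∑ t ∈ Finset.range n, (K ^ t) x A
      + ∑ t ∈ Finset.range n, (K ^ t) x Aᶜ := by
    rw [← Finset.sum_add_distrib]
    simp [prob_add_prob_compl (Set.to_countable A).measurableSet]
  have hn0 : (n : ℝ≥0∞) ≠ 0 := by exact_mod_cast hn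
  calc (1 : ℝ≥0∞) = n / n := (ENNReal.div_self hn0 (by simp)).symm
    _ = occupation K x n A + (∑ t ∈ Finset.range n, (K ^ t) x Aᶜ) / n := by
        rw [occupation, ← ENNReal.add_div, ← h1]
    _ ≤ _ := by
        gcongr
        exact ENNReal.div_le_of_le_mul h

/-- Pointwise limits can only lose mass, and tightness confines all but `ε` of it to a finite set,
where the sum commutes with the limit. -/
lemma tsum_limOccupation (htight : CesaroTight K) (x : S) : ∑' y, limOccupation K x y = 1 := by
  have hF : ∀ F : Finset S, Tendsto (fun n => occupation K x n F) (hyperfilter ℕ)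
      (𝓝 (∑ y ∈ F, limOccupation K x y)) := fun F => by
    simp_rw [occupation_finset]
    exact tendsto_finsetSum _ fun y _ => tendsto_limOccupation K x y
  refine le_antisymm ?_ ?_
  · rw [ENNReal.tsum_eq_iSup_sum]
    exact iSup_le fun F => le_of_tendsto (hF F) (Eventually.of_forall fun n =>
      occupation_le_one x n _)
  · refine ENNReal.le_of_forall_pos_le_add fun ε hε _ => ?_
    obtain ⟨F, hFf, hFt⟩ := htight ε (by exact_mod_cast hε)
    have h1 : ∀ᶠ n in (hyperfilter ℕ : Filter ℕ), 1 ≤ occupation K x n hFf.toFinset + ε := by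
      filter_upwards [hyperfilter_le_atTop (hFt x),
        hyperfilter_le_atTop (eventually_ge_atTop 1)] with n hn h1n
      refine one_le_occupation_add (by omega) ?_
      simpa using hn
    refine (ge_of_tendsto ((hF hFf.toFinset).add_const (ε : ℝ≥0∞)) h1).trans ?_
    gcongr
    exact ENNReal.sum_le_tsum _

/-- The measure with the point masses `limOccupation K x`. -/
noncomputable def limMeasure (K : Kernel S S) (x : S) : Measure S :=
  Measure.sum fun y => limOccupation K x y • Measure.dirac y

lemma lintegral_limMeasure (x : S) (f : S → ℝ≥0∞) :
    ∫⁻ y, f y ∂(limMeasure K x) = ∑' y, limOccupation K x y * f y := by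
  simp [limMeasure, lintegral_sum_measure, lintegral_smul_measure]

lemma limMeasure_singleton (x y : S) : limMeasure K x {y} = limOccupation K x y := by
  rw [← lintegral_indicator_one (measurableSet_singleton y), lintegral_limMeasure,
    tsum_eq_single y]
  · simp
  · intro z hz
    simp [hz]

lemma isProbabilityMeasure_limMeasure (htight : CesaroTight K) (x : S) :
    IsProbabilityMeasure (limMeasure K x) :=
  ⟨by rw [← lintegral_one, lintegral_limMeasure]; simp [tsum_limOccupation htight x]⟩

/-- Applying `K` shifts the time window by one slot, which adds at most one term of size at most `1`
to the unnormalized sum. -/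
lemma sum_occupation_mul_le (x y : S) (n : ℕ) (F : Finset S) :
    ∑ z ∈ F, occupation K x n {z} * K z {y} ≤ occupation K x n {y} + (n : ℝ≥0∞)⁻¹ := by
  have h : ∀ t, ∑ z ∈ F, (K ^ t) x {z} * K z {y} ≤ (K ^ (t + 1)) x {y} := fun t => by
    rw [Kernel.pow_succ_apply_eq_lintegral K t x (measurableSet_singleton y)]
    calc ∑ z ∈ F, (K ^ t) x {z} * K z {y} = ∫⁻ z in F, K z {y} ∂((K ^ t) x) := by
          rw [lintegral_finset]
          exact Finset.sum_congr rfl fun z _ => mul_comm _ _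
      _ ≤ _ := setLIntegral_le_lintegral _ _
  calc ∑ z ∈ F, occupation K x n {z} * K z {y}
      = (n : ℝ≥0∞)⁻¹ * ∑ t ∈ Finset.range n, ∑ z ∈ F, (K ^ t) x {z} * K z {y} := by
        simp only [occupation, ENNReal.div_eq_inv_mul]
        rw [Finset.sum_comm, Finset.mul_sum]
        refine Finset.sum_congr rfl fun z _ => ?_
        rw [mul_assoc, Finset.sum_mul]
    _ ≤ (n : ℝ≥0∞)⁻¹ * (∑ t ∈ Finset.range n, (K ^ t) x {y} + 1) := by
        gcongr
        calc ∑ t ∈ Finset.range n, ∑ z ∈ F, (K ^ t) x {z} * K z {y}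
            ≤ ∑ t ∈ Finset.range n, (K ^ (t + 1)) x {y} := Finset.sum_le_sum fun t _ => h t
          _ ≤ ∑ t ∈ Finset.range (n + 1), (K ^ t) x {y} := by
              rw [Finset.sum_range_succ']; exact le_self_add
          _ ≤ _ := by rw [Finset.sum_range_succ]; gcongr; exact prob_le_one
    _ = _ := by rw [mul_add, mul_one, occupation, ENNReal.div_eq_inv_mul]

/-- Restricting to finite sets yields only subinvariance in the limit; equality follows because both
measures have total mass one. -/
lemma invariant_limMeasure (htight : CesaroTight K) (x : S) :
    K.Invariant (limMeasure K x) := by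
  have := isProbabilityMeasure_limMeasure htight x
  have hle : (limMeasure K x).bind K ≤ limMeasure K x := by
    have hs : ∀ y, (limMeasure K x).bind K {y} ≤ limMeasure K x {y} := fun y => by
      rw [Measure.bind_apply (measurableSet_singleton y) K.aemeasurable, lintegral_limMeasure,
        limMeasure_singleton, ENNReal.tsum_eq_iSup_sum]
      refine iSup_le fun F => ?_
      have h1 : Tendsto (fun n => ∑ z ∈ F, occupation K x n {z} * K z {y}) (hyperfilter ℕ)
          (𝓝 (∑ z ∈ F, limOccupation K x z * K z {y})) :=
        tendsto_finsetSum _ fun z _ => ENNReal.Tendsto.mul_const (tendsto_limOccupation K x z)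
          (Or.inr (measure_ne_top _ _))
      have h2 : Tendsto (fun n : ℕ => occupation K x n {y} + (n : ℝ≥0∞)⁻¹) (hyperfilter ℕ)
          (𝓝 (limOccupation K x y + 0)) :=
        (tendsto_limOccupation K x y).add
          (ENNReal.tendsto_inv_nat_nhds_zero.mono_left hyperfilter_le_atTop)
      rw [add_zero] at h2
      exact le_of_tendsto_of_tendsto' h1 h2 fun n => sum_occupation_mul_le x y n F
    refine Measure.le_intro fun A hA _ => ?_
    rw [← Measure.tsum_indicator_apply_singleton _ _ hA,
      ← Measure.tsum_indicator_apply_singleton _ _ hA]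
    exact ENNReal.tsum_le_tsum fun y => Set.indicator_le_indicator (hs y)
  refine Measure.eq_of_le_of_measure_univ_eq hle ?_
  rw [Measure.bind_apply .univ K.aemeasurable]
  simp

lemma invariant_pow {π : Measure S} (h : K.Invariant π) (t : ℕ) : (K ^ t).Invariant π := by
  induction t with
  | zero => rw [pow_zero]; exact Measure.id_comp
  | succ t ih => rw [pow_succ]; exact ih.comp h

lemma measure_eq_lintegral_pow {π : Measure S} (h : K.Invariant π) (t : ℕ) (A : Set S) :
    π A = ∫⁻ y, (K ^ t) y A ∂π := by
  conv_lhs => rw [← invariant_pow h t]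
  exact Measure.bind_apply (Set.to_countable A).measurableSet (Kernel.aemeasurable _)

/-- The mean distance between the `t`-step distributions started from `x` and from `π`. -/
noncomputable def meanDist (K : Kernel S S) (π : Measure S) (t : ℕ) (x : S) : ℝ≥0∞ :=
  ∫⁻ y, (kernelDist K t x y + kernelDist K t y x) ∂π

/-- By invariance `π` is the mixture of the `t`-step laws over `y ∼ π`. The integrand of `meanDist`
contains both orders of the arguments, so both inequalities follow without proving `kernelDist`
symmetric. -/
lemma pow_apply_le_add_meanDist {π : Measure S} [IsProbabilityMeasure π] (h : K.Invariant π)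
    (t : ℕ) (x : S) (A : Set S) :
    (K ^ t) x A ≤ π A + meanDist K π t x ∧ π A ≤ (K ^ t) x A + meanDist K π t x := by
  have hA : MeasurableSet A := (Set.to_countable A).measurableSet
  rw [measure_eq_lintegral_pow h t A, meanDist]
  constructor
  · rw [← lintegral_add_left (measurable_of_countable _)]
    calc (K ^ t) x A = ∫⁻ _, (K ^ t) x A ∂π := by simp
      _ ≤ _ := lintegral_mono fun y => (pow_apply_le_add_kernelDist t x y hA).trans
          (by gcongr; exact le_self_add)
  · calc ∫⁻ y, (K ^ t) y A ∂π
        ≤ ∫⁻ y, ((K ^ t) x A + (kernelDist K t x y + kernelDist K t y x)) ∂π :=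
          lintegral_mono fun y => (pow_apply_le_add_kernelDist t y x hA).trans
            (by gcongr; exact le_add_self)
      _ = _ := by rw [lintegral_add_left (measurable_of_countable _)]; simp

lemma tendsto_meanDist {π : Measure S} [IsProbabilityMeasure π]
    (h : ∀ x y, limDist K x y = 0) (x : S) :
    Tendsto (fun t => meanDist K π t x) atTop (𝓝 0) := by
  have h1 : Tendsto (fun t => meanDist K π t x) atTop (𝓝 (∫⁻ _, 0 ∂π)) := by
    refine tendsto_lintegral_of_dominated_convergence (fun _ => 2)
      (fun t => measurable_of_countable _) (fun t => Eventually.of_forall fun y => ?_) (by simp)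
      (Eventually.of_forall fun y => ?_)
    · exact (add_le_add (kernelDist_le_one t x y) (kernelDist_le_one t y x)).trans
        (by norm_num)
    · simpa using (tendsto_kernelDist x y (h x y)).add (tendsto_kernelDist y x (h y x))
  simpa using h1

lemma tendsto_pow_apply {π : Measure S} [IsProbabilityMeasure π] (hπ : K.Invariant π)
    (h : ∀ x y, limDist K x y = 0) (x : S) (A : Set S) :
    Tendsto (fun t => (K ^ t) x A) atTop (𝓝 (π A)) := by
  have hm := tendsto_meanDist (π := π) h x
  have h1 : Tendsto (fun t => π A - meanDist K π t x) atTop (𝓝 (π A - 0)) :=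
    ENNReal.Tendsto.sub tendsto_const_nhds hm (Or.inl (measure_ne_top _ _))
  have h2 : Tendsto (fun t => π A + meanDist K π t x) atTop (𝓝 (π A + 0)) :=
    tendsto_const_nhds.add hm
  rw [tsub_zero] at h1
  rw [add_zero] at h2
  exact tendsto_of_tendsto_of_tendsto_of_le_of_le h1 h2
    (fun t => tsub_le_iff_right.mpr (pow_apply_le_add_meanDist hπ t x A).2)
    (fun t => (pow_apply_le_add_meanDist hπ t x A).1)

/-- A chain on a countable space with tight occupation measures and an accessible state with a
positive holding probability is Harris ergodic. -/
theorem isHarrisErgodic_of_cesaroTight {o : S} (hloop : 0 < K o {o})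
    (hreach : ∀ x, ∃ n, 0 < (K ^ n) x {o}) (htight : CesaroTight K) : IsHarrisErgodic K := by
  obtain ⟨c, hc, hcK⟩ := exists_uniform_mul_le hloop hreach htight
  have hlim : ∀ x y, limDist K x y = 0 := limDist_eq_zero hc hcK
  have hprob := isProbabilityMeasure_limMeasure htight o
  have hinv := invariant_limMeasure htight o
  refine ⟨limMeasure K o, hprob, hinv, fun π' hπ' hinv' => ?_, fun x => ?_⟩
  · ext A hA
    -- Uniqueness: the integral equals `π' A` for every `t`, while its integrand tends to the
    -- constant `limMeasure K o A`.
    have h1 : Tendsto (fun t => ∫⁻ y, (K ^ t) y A ∂π') atTop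
        (𝓝 (∫⁻ _, limMeasure K o A ∂π')) := by
      refine tendsto_lintegral_of_dominated_convergence (fun _ => 1)
        (fun t => measurable_of_countable _) (fun t => Eventually.of_forall fun y => prob_le_one)
        (by simp) (Eventually.of_forall fun y => tendsto_pow_apply hinv hlim y A)
    simp_rw [← measure_eq_lintegral_pow hinv' _ A] at h1
    have h2 := tendsto_nhds_unique tendsto_const_nhds h1
    simpa using h2
  · have hm := tendsto_meanDist (π := limMeasure K o) hlim x
    have hfin : ∀ t, meanDist K (limMeasure K o) t x ≠ ∞ := fun t => by
      refine ne_top_of_le_ne_top (b := ∫⁻ _, 2 ∂(limMeasure K o)) (by simp) ?_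
      exact lintegral_mono fun y =>
        (add_le_add (kernelDist_le_one t x y) (kernelDist_le_one t y x)).trans (by norm_num)
    have hm' : Tendsto (fun t => (meanDist K (limMeasure K o) t x).toReal) atTop (𝓝 0) := by
      simpa [Function.comp_def] using (ENNReal.tendsto_toReal ENNReal.zero_ne_top).comp hm
    refine squeeze_zero (fun t => Real.iSup_nonneg fun A => abs_nonneg _) (fun t => ?_) hm'
    refine Real.iSup_le (fun A => ?_) ENNReal.toReal_nonneg
    obtain ⟨h1, h2⟩ := pow_apply_le_add_meanDist hinv t x A.1
    have h1' := ENNReal.toReal_mono (by simp [hfin t]) h1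
    have h2' := ENNReal.toReal_mono (by simp [hfin t]) h2
    rw [ENNReal.toReal_add (measure_ne_top _ _) (hfin t)] at h1' h2'
    simp only [Measure.real]
    rw [abs_sub_le_iff]
    constructor <;> linarith

end Stationary

/-! ### Foster criterion and truncated quadratic functions -/

section Drift

open scoped ENNReal

/-- A Foster criterion for the tightness of the occupation measures. -/
lemma cesaroTight_of_drift {S : Type*} [MeasurableSpace S] [Countable S]
    [MeasurableSingletonClass S] {K : Kernel S S} [IsMarkovKernel K]
    (h : ∀ ε : ℝ, 0 < ε → ∃ (F : Set S) (W : S → ℝ≥0∞), F.Finite ∧ (∀ x, W x ≠ ∞) ∧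
      ∀ x, ∫⁻ y, W y ∂(K x) + Fᶜ.indicator 1 x ≤ W x + ENNReal.ofReal ε) :
    CesaroTight K := by
  intro ε hε
  -- One `η` is spent on the drift error and the other absorbs the initial value `W x` for large
  -- `n`. Thus `F` does not depend on `x`; only the threshold for `n` does.
  obtain ⟨η, hη, hηε⟩ : ∃ η : ℝ, 0 < η ∧ ENNReal.ofReal η + ENNReal.ofReal η ≤ ε := by
    obtain ⟨r, hr, hrε⟩ := ENNReal.lt_iff_exists_real_btwn.mp hε
    have hr0 : 0 < r := ENNReal.ofReal_pos.mp hrε.1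
    refine ⟨r / 2, by positivity, ?_⟩
    rw [← ENNReal.ofReal_add (by positivity) (by positivity), add_halves]
    exact hrε.2.le
  obtain ⟨F, W, hF, hW, hdrift⟩ := h η hη
  refine ⟨F, hF, fun x => ?_⟩
  have hFm : MeasurableSet Fᶜ := (Set.to_countable _).measurableSet
  have key : ∀ n : ℕ, ∫⁻ y, W y ∂((K ^ n) x) + ∑ t ∈ Finset.range n, (K ^ t) x Fᶜ
      ≤ W x + ENNReal.ofReal η * n := by
    intro n
    induction n with
    | zero =>
      have : (K ^ 0) x = Measure.dirac x := by
        rw [pow_zero]; exact Kernel.id_apply x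
      rw [this]
      simp
    | succ n ih =>
      have h1 : ∫⁻ y, W y ∂((K ^ (n + 1)) x) = ∫⁻ z, ∫⁻ y, W y ∂(K z) ∂((K ^ n) x) := by
        rw [pow_succ']
        exact Kernel.lintegral_comp _ _ _ (measurable_of_countable _)
      calc ∫⁻ y, W y ∂((K ^ (n + 1)) x) + ∑ t ∈ Finset.range (n + 1), (K ^ t) x Fᶜ
          = (∫⁻ z, (∫⁻ y, W y ∂(K z) + Fᶜ.indicator 1 z) ∂((K ^ n) x))
              + ∑ t ∈ Finset.range n, (K ^ t) x Fᶜ := by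
            rw [h1, lintegral_add_left (measurable_of_countable _),
              lintegral_indicator_one hFm, Finset.sum_range_succ]
            ring
        _ ≤ (∫⁻ z, (W z + ENNReal.ofReal η) ∂((K ^ n) x))
              + ∑ t ∈ Finset.range n, (K ^ t) x Fᶜ := by
            exact add_le_add (lintegral_mono fun z => hdrift z) le_rfl
        _ = (∫⁻ z, W z ∂((K ^ n) x) + ∑ t ∈ Finset.range n, (K ^ t) x Fᶜ)
              + ENNReal.ofReal η := by
            rw [lintegral_add_left (measurable_of_countable _)]
            simp only [lintegral_const, measure_univ, mul_one]
            ring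
        _ ≤ W x + ENNReal.ofReal η * n + ENNReal.ofReal η := by gcongr
        _ = _ := by push_cast; ring
  obtain ⟨N, hN⟩ : ∃ N : ℕ, W x ≤ ENNReal.ofReal η * N := by
    obtain ⟨N, hN⟩ := exists_nat_ge ((W x).toReal / η)
    refine ⟨N, ?_⟩
    rw [← ENNReal.ofReal_toReal (hW x), ← ENNReal.ofReal_natCast N, ← ENNReal.ofReal_mul hη.le]
    refine ENNReal.ofReal_le_ofReal ?_
    rwa [div_le_iff₀' hη] at hN
  filter_upwards [eventually_ge_atTop N] with n hn
  calc ∑ t ∈ Finset.range n, (K ^ t) x Fᶜ ≤ W x + ENNReal.ofReal η * n :=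
        le_add_self.trans (key n)
    _ ≤ ENNReal.ofReal η * n + ENNReal.ofReal η * n := by
        gcongr
        refine hN.trans ?_
        gcongr
    _ = (ENNReal.ofReal η + ENNReal.ofReal η) * n := by ring
    _ ≤ ε * n := by gcongr

/-- The truncation of a real number to the interval `[0, L]`. -/
noncomputable def truncate (L x : ℝ) : ℝ := max 0 (min x L)

/-- The convex function with derivative `truncate L` that vanishes on the negative half-line. -/
noncomputable def huber (L x : ℝ) : ℝ := truncate L x * x - truncate L x ^ 2 / 2

variable {L : ℝ}

lemma truncate_nonneg (L x : ℝ) : 0 ≤ truncate L x := le_max_left _ _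

lemma truncate_le (hL : 0 ≤ L) (x : ℝ) : truncate L x ≤ L := max_le hL (min_le_right _ _)

lemma truncate_mono {x y : ℝ} (h : x ≤ y) : truncate L x ≤ truncate L y :=
  max_le_max_left _ (min_le_min_right _ h)

lemma truncate_of_le (hL : 0 ≤ L) {x : ℝ} (h : L ≤ x) : truncate L x = L := by
  rw [truncate, min_eq_right h, max_eq_right hL]

lemma truncate_zero (hL : 0 ≤ L) : truncate L 0 = 0 := by
  rw [truncate, min_eq_left hL, max_self]

lemma abs_truncate_sub_le (x y : ℝ) : |truncate L y - truncate L x| ≤ |y - x| := by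
  refine (abs_max_sub_max_le_max 0 (min y L) 0 (min x L)).trans ?_
  refine max_le (by simp) ((abs_min_sub_min_le_max y L x L).trans ?_)
  simp

/-- `huber L x` is the maximum of `c * x - c ^ 2 / 2` over `c ∈ [0, L]`, attained at `c = truncate L
x`. This variational form supplies convexity without derivatives. -/
lemma mul_sub_sq_le_huber (x : ℝ) {c : ℝ} (hc : 0 ≤ c) (hcL : c ≤ L) :
    c * x - c ^ 2 / 2 ≤ huber L x := by
  unfold huber truncate
  rcases le_total x L with h | h
  · rw [min_eq_left h]
    rcases le_total 0 x with h0 | h0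
    · rw [max_eq_right h0]; nlinarith [sq_nonneg (x - c)]
    · rw [max_eq_left h0]; nlinarith
  · rw [min_eq_right h, max_eq_right (hc.trans hcL)]
    nlinarith [mul_nonneg (sub_nonneg.2 hcL) (sub_nonneg.2 h), sq_nonneg (L - c)]

lemma huber_nonneg (hL : 0 ≤ L) (x : ℝ) : 0 ≤ huber L x := by
  simpa using mul_sub_sq_le_huber x le_rfl hL

lemma huber_le (hL : 0 ≤ L) (x : ℝ) : huber L x ≤ L * |x| := by
  unfold huber
  have h1 := truncate_nonneg L x
  have h2 := truncate_le hL x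
  nlinarith [sq_nonneg (truncate L x), mul_le_mul_of_nonneg_left (le_abs_self x) h1,
    mul_le_mul_of_nonneg_right h2 (abs_nonneg x)]

/-- The slope `truncate L` is 1-Lipschitz and takes values in `[0, L]`, so over a displacement `d`
it changes by at most `min H L`. -/
lemma huber_add_le (hL : 0 ≤ L) (x d : ℝ) {H : ℝ} (hd : |d| ≤ H) :
    huber L (x + d) ≤ huber L x + truncate L x * d + min H L * H := by
  have h1 := mul_sub_sq_le_huber (L := L) x (truncate_nonneg L (x + d)) (truncate_le hL (x + d))
  have h2 : (truncate L (x + d) - truncate L x) * d ≤ min H L * H := by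
    calc (truncate L (x + d) - truncate L x) * d
        ≤ |truncate L (x + d) - truncate L x| * |d| := by
          rw [← abs_mul]; exact le_abs_self _
      _ ≤ min H L * H := by
          refine mul_le_mul (le_min ?_ ?_) hd (abs_nonneg _) (le_min ((abs_nonneg d).trans hd) hL)
          · refine (abs_truncate_sub_le x (x + d)).trans ?_
            simpa using hd
          · rw [abs_sub_le_iff]
            have h3 := truncate_nonneg L (x + d)
            have h4 := truncate_nonneg L x
            have h5 := truncate_le hL (x + d)
            have h6 := truncate_le hL x
            constructor <;> linarith
  have h3 : huber L (x + d) = truncate L (x + d) * (x + d) - truncate L (x + d) ^ 2 / 2 := rfl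
  linarith

variable {Ω : Type*} [MeasurableSpace Ω] {ν : Measure Ω}

lemma measurable_truncate : Measurable (truncate L) := by
  unfold truncate; fun_prop

lemma measurable_huber : Measurable (huber L) := by
  unfold huber
  have := measurable_truncate (L := L)
  fun_prop

lemma integrable_min_mul (hL : 0 ≤ L) {H : Ω → ℝ} (hH : Integrable H ν) (hH0 : ∀ ω, 0 ≤ H ω) :
    Integrable (fun ω => min (H ω) L * H ω) ν := by
  refine Integrable.mono' (hH.const_mul L) ?_ (Eventually.of_forall fun ω => ?_)
  · exact (hH.aestronglyMeasurable.inf aestronglyMeasurable_const).mul hH.aestronglyMeasurable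
  · rw [Real.norm_of_nonneg (mul_nonneg (le_min (hH0 ω) hL) (hH0 ω))]
    exact mul_le_mul_of_nonneg_right (min_le_right _ _) (hH0 ω)

lemma integrable_huber [IsFiniteMeasure ν] (hL : 0 ≤ L) {D : Ω → ℝ} (hD : Integrable D ν)
    (x : ℝ) : Integrable (fun ω => huber L (x + D ω)) ν := by
  have h1 : Integrable (fun ω => x + D ω) ν := (integrable_const x).add hD
  refine Integrable.mono' (h1.abs.const_mul L) ?_ (Eventually.of_forall fun ω => ?_)
  · exact (measurable_huber.comp_aemeasurable h1.aemeasurable).aestronglyMeasurable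
  · rw [Real.norm_of_nonneg (huber_nonneg hL _)]
    exact huber_le hL _

lemma integral_huber_le [IsProbabilityMeasure ν] (hL : 0 ≤ L) {D H : Ω → ℝ}
    (hD : Integrable D ν) (hH : Integrable H ν) (hDH : ∀ ω, |D ω| ≤ H ω) (x : ℝ) :
    ∫ ω, huber L (x + D ω) ∂ν
      ≤ huber L x + truncate L x * ∫ ω, D ω ∂ν + ∫ ω, min (H ω) L * H ω ∂ν := by
  have hH' := integrable_min_mul hL hH fun ω => (abs_nonneg _).trans (hDH ω)
  have h1 : Integrable (fun ω => huber L x + truncate L x * D ω) ν :=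
    (integrable_const _).add (hD.const_mul _)
  calc ∫ ω, huber L (x + D ω) ∂ν
      ≤ ∫ ω, (huber L x + truncate L x * D ω + min (H ω) L * H ω) ∂ν :=
        integral_mono (integrable_huber hL hD x) (h1.add hH') fun ω =>
          huber_add_le hL x (D ω) (hDH ω)
    _ = _ := by
        rw [integral_add h1 hH', integral_add (integrable_const _) (hD.const_mul _),
          integral_const_mul]
        simp

/-- Substitute for a second moment: the quotient is dominated by `H` and, pointwise, by `H ^ 2 / L`,
so dominated convergence applies. -/
lemma tendsto_integral_min_mul_div {H : Ω → ℝ} (hH : Integrable H ν)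
    (hH0 : ∀ ω, 0 ≤ H ω) :
    Tendsto (fun L : ℕ => (∫ ω, min (H ω) L * H ω ∂ν) / L) atTop (𝓝 0) := by
  have h : Tendsto (fun L : ℕ => ∫ ω, min (H ω) L * H ω / L ∂ν) atTop (𝓝 (∫ _, 0 ∂ν)) := by
    refine tendsto_integral_of_dominated_convergence H (fun L => ?_) hH
      (fun L => Eventually.of_forall fun ω => ?_) (Eventually.of_forall fun ω => ?_)
    · exact ((integrable_min_mul L.cast_nonneg hH hH0).div_const _).aestronglyMeasurable
    · have hL : (0 : ℝ) ≤ L := L.cast_nonneg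
      rw [Real.norm_of_nonneg (by have := hH0 ω; positivity)]
      refine div_le_of_le_mul₀ hL (hH0 ω) ?_
      rw [mul_comm (H ω)]
      exact mul_le_mul_of_nonneg_right (min_le_right _ _) (hH0 ω)
    · refine squeeze_zero (fun L => ?_) (fun L => ?_)
        (tendsto_const_div_atTop_nhds_zero_nat (H ω * H ω))
      · have := hH0 ω; positivity
      · have := hH0 ω
        gcongr
        exact min_le_left _ _
  simpa [integral_div] using h

end Drift

/-! ### One slot: workloads and their mean increments -/

section Slot

variable {M : ℕ}

/-- The random inputs of one slot: decisions, red arrivals and green arrivals, by station. -/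
abbrev SlotInput (M : ℕ) : Type := (Fin M → Bool) × (Fin M → ℕ) × (Fin M → ℕ)

variable [NeZero M]

/-- One step of the relabelled process. -/
noncomputable def relabelledStep (z : QState M) (n : SlotInput M) : QState M :=
  (fun k => (slotStep 0 n.1 n.2.1 n.2.2 z).1 (k + 1),
   fun k => (slotStep 0 n.1 n.2.1 n.2.2 z).2 (k + 1))

/-- The transition kernel of the relabelled process when the slot inputs have the law `ν`. -/
noncomputable def slotKernel (ν : Measure (SlotInput M)) : Kernel (QState M) (QState M) :=
  Kernel.ofFunOfCountable fun z => ν.map (relabelledStep z)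

lemma slotKernel_apply (ν : Measure (SlotInput M)) (z : QState M) :
    slotKernel ν z = ν.map (relabelledStep z) := rfl

instance (ν : Measure (SlotInput M)) [IsProbabilityMeasure ν] : IsMarkovKernel (slotKernel ν) :=
  ⟨fun z => by
    rw [slotKernel_apply]
    exact Measure.isProbabilityMeasure_map (measurable_of_countable _).aemeasurable⟩

open Classical in
/-- The indicator that the scheduled station has a red message. -/
noncomputable def busy (z : QState M) : ℝ := if 0 < z.1 0 then 1 else 0

open Classical in
/-- The indicator of a successful green transmission of station `j`. -/
noncomputable def success (z : QState M) (j : Fin M) (n : SlotInput M) : ℝ :=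
  if Succeeds 0 z n.1 j then 1 else 0

lemma relabelledStep_red (z : QState M) (n : SlotInput M) (k : Fin M) :
    ((relabelledStep z n).1 k : ℝ)
      = z.1 (k + 1) - (if k + 1 = 0 then busy z else 0) + n.2.1 (k + 1) := by
  simp only [relabelledStep, slotStep, busy]
  by_cases h0 : k + 1 = 0
  · rw [h0]
    by_cases hb : 0 < z.1 0
    · simp [hb, Nat.cast_sub (show 1 ≤ z.1 0 from hb)]
    · simp [hb]
  · simp [h0]

lemma relabelledStep_green (z : QState M) (n : SlotInput M) (k : Fin M) :
    ((relabelledStep z n).2 k : ℝ) = z.2 (k + 1) - success z (k + 1) n + n.2.2 (k + 1) := by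
  simp only [relabelledStep, slotStep, success]
  by_cases hs : Succeeds 0 z n.1 (k + 1)
  · have : 1 ≤ z.2 (k + 1) := hs.1.1
    simp [hs, Nat.cast_sub this]
  · simp [hs]

lemma sum_add_one {α : Type*} [AddCommMonoid α] (f : Fin M → α) :
    ∑ k, f (k + 1) = ∑ k, f k :=
  Equiv.sum_comp (Equiv.addRight (1 : Fin M)) f

lemma sum_relabelledStep_red (z : QState M) (n : SlotInput M) :
    ∑ k, ((relabelledStep z n).1 k : ℝ) = ∑ k, (z.1 k : ℝ) - busy z + ∑ k, (n.2.1 k : ℝ) := by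
  simp_rw [relabelledStep_red]
  rw [sum_add_one fun j => (z.1 j : ℝ) - (if j = 0 then busy z else 0) + n.2.1 j]
  simp [Finset.sum_add_distrib]

lemma coe_add_one_eq (k : Fin M) :
    (((k + 1 : Fin M) : ℕ) : ℝ) = (k : ℕ) + 1 - (if k + 1 = 0 then (M : ℝ) else 0) := by
  have h : ((k + 1 : Fin M) : ℕ) = (k + 1) % M := by
    rw [Fin.val_add, Fin.val_one', Nat.add_mod_mod]
  rcases (Nat.succ_le_of_lt k.2).lt_or_eq with hk | hk
  · have h1 : ((k + 1 : Fin M) : ℕ) = k + 1 := by rw [h, Nat.mod_eq_of_lt hk]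
    have h2 : k + 1 ≠ 0 := fun h0 => by rw [h0] at h1; simp at h1
    simp [h1, h2]
  · have h1 : ((k + 1 : Fin M) : ℕ) = 0 := by
      rw [h, show (k : ℕ) + 1 = M from hk, Nat.mod_self]
    have h2 : k + 1 = 0 := Fin.ext (by simpa using h1)
    have h3 : (M : ℝ) = (k : ℕ) + 1 := by exact_mod_cast hk.symm
    rw [h1, if_pos h2, h3]; simp

/-- The red workload at position `k`: the red messages, weighted by the period of the schedule, and
the time until the station is scheduled. -/
noncomputable def redLoad (z : QState M) (k : Fin M) : ℝ := M * z.1 k + (k : ℕ)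

/-- The green queue at position `k`, corrected by the influence of the red queues. -/
noncomputable def greenLoad (β γ : ℝ) (z : QState M) (k : Fin M) : ℝ :=
  z.2 k + β * z.1 k - γ * ∑ j, (z.1 j : ℝ)

/-- The increment of the red workload of the station at position `j`. -/
noncomputable def redIncr (z : QState M) (j : Fin M) (n : SlotInput M) : ℝ :=
  M * n.2.1 j - 1 + (if j = 0 then M * (1 - busy z) else 0)

/-- The increment of the corrected green queue of the station at position `j`. -/
noncomputable def greenIncr (β γ : ℝ) (z : QState M) (j : Fin M) (n : SlotInput M) : ℝ :=
  n.2.2 j - success z j n + β * (n.2.1 j - (if j = 0 then busy z else 0))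
    - γ * (∑ i, (n.2.1 i : ℝ) - busy z)

/-- Moving one position forward lowers the load by `1`. For the scheduled station a transmission
removes `M`, while the jump to position `M - 1` adds `M - 1`: again a net `-1`. Without a
transmission there remains the surplus `M`. -/
lemma redLoad_step (z : QState M) (n : SlotInput M) (k : Fin M) :
    redLoad (relabelledStep z n) k = redLoad z (k + 1) + redIncr z (k + 1) n := by
  rw [redLoad, redLoad, redIncr, relabelledStep_red, coe_add_one_eq]
  split_ifs <;> ring

lemma greenLoad_step (β γ : ℝ) (z : QState M) (n : SlotInput M) (k : Fin M) :
    greenLoad β γ (relabelledStep z n) k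
      = greenLoad β γ z (k + 1) + greenIncr β γ z (k + 1) n := by
  rw [greenLoad, greenLoad, greenIncr, relabelledStep_red, relabelledStep_green,
    sum_relabelledStep_red]
  ring

/-- A bound for the increments. -/
noncomputable def incrBound (n : SlotInput M) : ℝ :=
  (M + 2) * ∑ i, (n.2.1 i : ℝ) + ∑ i, (n.2.2 i : ℝ) + (M + 3)

lemma busy_mem (z : QState M) : 0 ≤ busy z ∧ busy z ≤ 1 := by
  unfold busy; split_ifs <;> simp

lemma success_mem (z : QState M) (j : Fin M) (n : SlotInput M) :
    0 ≤ success z j n ∧ success z j n ≤ 1 := by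
  unfold success; split_ifs <;> simp

lemma one_le_cast : (1 : ℝ) ≤ M := by exact_mod_cast NeZero.one_le

lemma abs_redIncr_le (z : QState M) (j : Fin M) (n : SlotInput M) :
    |redIncr z j n| ≤ incrBound n := by
  have h1 : (n.2.1 j : ℝ) ≤ ∑ i, (n.2.1 i : ℝ) :=
    Finset.single_le_sum (f := fun i => (n.2.1 i : ℝ)) (fun i _ => by positivity)
      (Finset.mem_univ j)
  have h2 : (0 : ℝ) ≤ ∑ i, (n.2.2 i : ℝ) := by positivity
  have h3 : (0 : ℝ) ≤ n.2.1 j := by positivity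
  obtain ⟨hb0, hb1⟩ := busy_mem z
  have hM := one_le_cast (M := M)
  have h4 : (M : ℝ) * n.2.1 j ≤ M * ∑ i, (n.2.1 i : ℝ) := by gcongr
  have h5 : 0 ≤ (M : ℝ) * n.2.1 j := by positivity
  have h6 : 0 ≤ (M : ℝ) * (1 - busy z) := mul_nonneg (by positivity) (by linarith)
  have h7 : (M : ℝ) * (1 - busy z) ≤ M := mul_le_of_le_one_right (by positivity) (by linarith)
  unfold redIncr incrBound
  rw [abs_le]
  split_ifs <;> constructor <;> linarith

lemma abs_greenIncr_le {β γ : ℝ} (hβ : 0 ≤ β) (hβ1 : β ≤ 1) (hγ : 0 ≤ γ) (hγ1 : γ ≤ 1)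
    (z : QState M) (j : Fin M) (n : SlotInput M) :
    |greenIncr β γ z j n| ≤ incrBound n := by
  have h1 : (n.2.1 j : ℝ) ≤ ∑ i, (n.2.1 i : ℝ) :=
    Finset.single_le_sum (f := fun i => (n.2.1 i : ℝ)) (fun i _ => by positivity)
      (Finset.mem_univ j)
  have h2 : (n.2.2 j : ℝ) ≤ ∑ i, (n.2.2 i : ℝ) :=
    Finset.single_le_sum (f := fun i => (n.2.2 i : ℝ)) (fun i _ => by positivity)
      (Finset.mem_univ j)
  have h3 : (0 : ℝ) ≤ n.2.1 j := by positivity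
  have h3' : (0 : ℝ) ≤ n.2.2 j := by positivity
  obtain ⟨hb0, hb1⟩ := busy_mem z
  obtain ⟨hs0, hs1⟩ := success_mem z j n
  have hM := one_le_cast (M := M)
  set A := ∑ i, (n.2.1 i : ℝ)
  have hx : ∀ x : ℝ, 0 ≤ x → x ≤ 1 → |β * (n.2.1 j - x)| ≤ A + 1 := fun x hx0 hx1 => by
    rw [abs_mul, abs_of_nonneg hβ]
    refine (mul_le_of_le_one_left (abs_nonneg _) hβ1).trans ?_
    rw [abs_le]; constructor <;> linarith
  have hy : |γ * (A - busy z)| ≤ A + 1 := by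
    rw [abs_mul, abs_of_nonneg hγ]
    refine (mul_le_of_le_one_left (abs_nonneg _) hγ1).trans ?_
    rw [abs_le]; constructor <;> linarith
  have hx' := hx (if j = 0 then busy z else 0) (by split_ifs <;> simp [hb0])
    (by split_ifs <;> simp [hb1])
  have h8 : 0 ≤ (M : ℝ) * A := mul_nonneg (by positivity) (h3.trans h1)
  rw [abs_le] at hx' hy
  unfold greenIncr incrBound
  rw [abs_le]
  constructor <;> linarith [hx'.1, hx'.2, hy.1, hy.2]

/-- The assumptions on the law of the slot inputs that the drift estimates use. -/
structure SlotLaw (ν : Measure (SlotInput M)) (p lamR lamG : ℝ) : Prop where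
  integrable_red : ∀ k, Integrable (fun n : SlotInput M => (n.2.1 k : ℝ)) ν
  integrable_green : ∀ k, Integrable (fun n : SlotInput M => (n.2.2 k : ℝ)) ν
  mean_red : ∀ k, ∫ n, (n.2.1 k : ℝ) ∂ν = lamR / M
  mean_green : ∀ k, ∫ n, (n.2.2 k : ℝ) ∂ν = lamG / M
  coin : ∀ (k : Fin M) (T : Finset (Fin M)), k ∉ T →
    ν.real {n | n.1 k = true ∧ ∀ j ∈ T, n.1 j = false} = p * (1 - p) ^ T.card

variable {ν : Measure (SlotInput M)} [IsProbabilityMeasure ν] {p lamR lamG : ℝ}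

lemma integrable_success (z : QState M) (j : Fin M) : Integrable (success z j) ν :=
  Integrable.of_bound (measurable_of_countable _).aestronglyMeasurable 1
    (Eventually.of_forall fun n => by
      rw [Real.norm_of_nonneg (success_mem z j n).1]; exact (success_mem z j n).2)

namespace SlotLaw

variable (h : SlotLaw ν p lamR lamG)

include h

lemma integrable_incrBound : Integrable incrBound ν :=
  (((integrable_finsetSum _ fun k _ => h.integrable_red k).const_mul _).add
    (integrable_finsetSum _ fun k _ => h.integrable_green k)).add (integrable_const _)

lemma integrable_redIncr (z : QState M) (j : Fin M) : Integrable (redIncr z j) ν :=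
  (((h.integrable_red j).const_mul _).sub (integrable_const _)).add (integrable_const _)

lemma integral_redIncr (z : QState M) (j : Fin M) :
    ∫ n, redIncr z j n ∂ν = lamR - 1 + (if j = 0 then M * (1 - busy z) else 0) := by
  unfold redIncr
  have h1 := (h.integrable_red j).const_mul (M : ℝ)
  have h2 : Integrable (fun n : SlotInput M => (M : ℝ) * n.2.1 j - 1) ν :=
    h1.sub (integrable_const _)
  have hM := one_le_cast (M := M)
  rw [integral_add h2 (integrable_const _),
    integral_sub h1 (integrable_const _), integral_const_mul, h.mean_red]
  simp only [integral_const, probReal_univ, one_smul]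
  field_simp

lemma integrable_greenIncr (β γ : ℝ) (z : QState M) (j : Fin M) :
    Integrable (greenIncr β γ z j) ν :=
  (((h.integrable_green j).sub (integrable_success z j)).add
    (((h.integrable_red j).sub (integrable_const _)).const_mul β)).sub
    (((integrable_finsetSum _ fun k _ => h.integrable_red k).sub (integrable_const _)).const_mul γ)

lemma integral_greenIncr (β γ : ℝ) (z : QState M) (j : Fin M) :
    ∫ n, greenIncr β γ z j n ∂ν = lamG / M - ∫ n, success z j n ∂ν
      + β * (lamR / M - (if j = 0 then busy z else 0)) - γ * (lamR - busy z) := by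
  unfold greenIncr
  have h1 : Integrable (fun n : SlotInput M => (n.2.2 j : ℝ) - success z j n) ν :=
    (h.integrable_green j).sub (integrable_success z j)
  have h2 : Integrable (fun n : SlotInput M =>
      β * ((n.2.1 j : ℝ) - (if j = 0 then busy z else 0))) ν :=
    ((h.integrable_red j).sub (integrable_const _)).const_mul β
  have h3 : Integrable (fun n : SlotInput M => ∑ i, (n.2.1 i : ℝ)) ν :=
    integrable_finsetSum Finset.univ fun k _ => h.integrable_red k
  have h4 : Integrable (fun n : SlotInput M => γ * (∑ i, (n.2.1 i : ℝ) - busy z)) ν :=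
    (h3.sub (integrable_const _)).const_mul γ
  have h12 : Integrable (fun n : SlotInput M => (n.2.2 j : ℝ) - success z j n
      + β * ((n.2.1 j : ℝ) - (if j = 0 then busy z else 0))) ν := h1.add h2
  have hM := one_le_cast (M := M)
  rw [integral_sub h12 h4, integral_add h1 h2,
    integral_sub (h.integrable_green j) (integrable_success z j), integral_const_mul,
    integral_const_mul, integral_sub (h.integrable_red j) (integrable_const _),
    integral_sub h3 (integrable_const _),
    integral_finsetSum _ fun k _ => h.integrable_red k]
  simp only [h.mean_red, h.mean_green, integral_const, probReal_univ, one_smul,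
    Finset.sum_const, Finset.card_univ, Fintype.card_fin, nsmul_eq_mul]
  field_simp

/-- Success is certain when `j` decides to transmit and all of `T` stay silent. The only competitor
that may be left out of `T` is a scheduled station occupied by a red message. -/
lemma le_integral_success {z : QState M} {j : Fin M} (hj : 0 < z.2 j) (T : Finset (Fin M))
    (hjT : j ∉ T) (hT : ∀ i, i ≠ j → i ∉ T → i = 0 ∧ 0 < z.1 0) (hjb : ¬ (j = 0 ∧ 0 < z.1 0)) :
    p * (1 - p) ^ T.card ≤ ∫ n, success z j n ∂ν := by
  rw [← h.coin j T hjT, ← integral_indicator_one (Set.to_countable _).measurableSet]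
  refine integral_mono ((integrable_indicator_iff (Set.to_countable _).measurableSet).2
    (integrable_const _).integrableOn) (integrable_success z j) fun n => ?_
  refine Set.indicator_le' (fun n hn => ?_) (fun n _ => (success_mem z j n).1) n
  have : Succeeds 0 z n.1 j := by
    refine ⟨⟨hj, hn.1, fun hh => hjb ⟨hh.1, hh.1 ▸ hh.2⟩⟩, fun i hij hi => ?_⟩
    by_cases hiT : i ∈ T
    · have := hn.2 i hiT
      rw [hi.2.1] at this
      exact Bool.noConfusion this
    · obtain ⟨rfl, hb⟩ := hT i hij hiT
      exact hi.2.2 ⟨rfl, hb⟩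
  simp [success, this]

/-- The coefficients `β` and `β - α` are chosen so that green service plus the change in the red
correction is at least `α` in every configuration with `z.2 j > 0`. The indicator covers an empty
green queue. -/
lemma integral_greenIncr_le (hp0 : 0 ≤ p) (hp1 : p ≤ 1) (z : QState M) (j : Fin M) :
    ∫ n, greenIncr (p * (1 - p) ^ (M - 2)) (p * (1 - p) ^ (M - 2) - p * (1 - p) ^ (M - 1)) z j n ∂ν
      ≤ -((lamR * (M - 1) * p * (1 - p) ^ (M - 2) + (1 - lamR) * M * p * (1 - p) ^ (M - 1)
          - lamG) / M) + (if z.2 j = 0 then 1 else 0) := by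
  have hM := one_le_cast (M := M)
  set σ := ∫ n, success z j n ∂ν with hσ
  set α := p * (1 - p) ^ (M - 1) with hα
  set β := p * (1 - p) ^ (M - 2) with hβ
  have hq0 : 0 ≤ 1 - p := by linarith
  have hq1 : 1 - p ≤ 1 := by linarith
  have hα0 : 0 ≤ α := by positivity
  have hβ1 : β ≤ 1 := mul_le_one₀ hp1 (by positivity) (pow_le_one₀ hq0 hq1)
  have hαβ : α ≤ β := mul_le_mul_of_nonneg_left
    (pow_le_pow_of_le_one hq0 hq1 (by omega)) hp0
  have hσ0 : 0 ≤ σ := integral_nonneg fun n => (success_mem z j n).1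
  -- With green messages at `j`: a busy slot gives `0 + β - (β - α)` at `j = 0` and at least `β - (β
  -- - α)` elsewhere; an idle one gives at least `α`. With none, `1 ≥ β` suffices.
  have key : α - (if z.2 j = 0 then 1 else 0)
      ≤ σ + β * (if j = 0 then busy z else 0) - (β - α) * busy z := by
    by_cases hg : z.2 j = 0
    · simp only [hg, if_true]
      obtain ⟨hb0, hb1⟩ := busy_mem z
      have h1 : 0 ≤ β * (if j = 0 then busy z else 0) :=
        mul_nonneg (hα0.trans hαβ) (by split_ifs <;> simp [hb0])
      have h2 : (β - α) * busy z ≤ β - α := mul_le_of_le_one_right (by linarith) hb1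
      linarith
    · have hg' : 0 < z.2 j := Nat.pos_of_ne_zero hg
      simp only [hg, if_false]
      by_cases hb : 0 < z.1 0
      · have hbz : busy z = 1 := by simp [busy, hb]
        rw [hbz]
        by_cases hj : j = 0
        · simp only [hj, if_true]; linarith
        · simp only [hj, if_false]
          have h3 := h.le_integral_success hg' ((Finset.univ.erase j).erase 0) (by simp)
            (fun i hij hi => ⟨by by_contra h0; simp [hij, h0] at hi, hb⟩) (fun hh => hj hh.1)
          rw [Finset.card_erase_of_mem (by simpa using Ne.symm hj),
            Finset.card_erase_of_mem (Finset.mem_univ _), Finset.card_univ, Fintype.card_fin,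
            Nat.sub_sub] at h3
          linarith
      · have hbz : busy z = 0 := by simp [busy, hb]
        have h3 := h.le_integral_success hg' (Finset.univ.erase j) (by simp)
          (fun i hij hi => absurd (Finset.mem_erase.2 ⟨hij, Finset.mem_univ _⟩) hi)
          (fun hh => hb hh.2)
        rw [Finset.card_erase_of_mem (Finset.mem_univ _), Finset.card_univ,
          Fintype.card_fin] at h3
        rw [hbz]
        simp only [ite_self]
        linarith
  rw [h.integral_greenIncr]
  have h5 : (lamR * (M - 1) * p * (1 - p) ^ (M - 2) + (1 - lamR) * M * p * (1 - p) ^ (M - 1)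
      - lamG) / M = (lamR * (M - 1) * β + (1 - lamR) * M * α - lamG) / M := by
    rw [hα, hβ]; ring
  have h6 : (lamR * (M - 1) * β + (1 - lamR) * M * α - lamG) / M
      = lamR * β - lamR * β / M + (1 - lamR) * α - lamG / M := by
    field_simp
  rw [h5, h6]
  have h7 : β * (lamR / M) = lamR * β / M := by ring
  nlinarith [key, h7]

end SlotLaw

end Slot

/-! ### Lyapunov drift and tightness -/

section SlotTight

open scoped ENNReal

variable {M : ℕ} [NeZero M] {L : ℝ}

/-- A Lyapunov function for the relabelled process. -/
noncomputable def lyapunov (L β γ c : ℝ) (z : QState M) : ℝ :=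
  ∑ k, huber L (greenLoad β γ z k) + c * ∑ k, huber L (redLoad z k)

lemma lyapunov_nonneg (hL : 0 ≤ L) (β γ : ℝ) {c : ℝ} (hc : 0 ≤ c) (z : QState M) :
    0 ≤ lyapunov L β γ c z :=
  add_nonneg (Finset.sum_nonneg fun _ _ => huber_nonneg hL _)
    (mul_nonneg hc (Finset.sum_nonneg fun _ _ => huber_nonneg hL _))

lemma lyapunov_step (L β γ c : ℝ) (z : QState M) (n : SlotInput M) :
    lyapunov L β γ c (relabelledStep z n)
      = ∑ j, huber L (greenLoad β γ z j + greenIncr β γ z j n)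
        + c * ∑ j, huber L (redLoad z j + redIncr z j n) := by
  simp_rw [lyapunov, greenLoad_step, redLoad_step]
  rw [sum_add_one fun j => huber L (greenLoad β γ z j + greenIncr β γ z j n),
    sum_add_one fun j => huber L (redLoad z j + redIncr z j n)]

variable {ν : Measure (SlotInput M)} [IsProbabilityMeasure ν] {p lamR lamG : ℝ}

lemma incrBound_nonneg (n : SlotInput M) : 0 ≤ incrBound n := by
  unfold incrBound; positivity

/-- The positive part of the red drift occurs only at an idle scheduled station, whose load is `0`,
where the slope of `huber` vanishes. -/
lemma truncate_redLoad_mul (hL : 0 ≤ L) (z : QState M) (j : Fin M) :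
    truncate L (redLoad z j) * (if j = 0 then M * (1 - busy z) else 0) = 0 := by
  split_ifs with hj
  · subst hj
    by_cases hb : 0 < z.1 0
    · simp [busy, hb]
    · have h0 : redLoad z 0 = 0 := by
        simp [redLoad, Nat.eq_zero_of_not_pos hb]
      rw [h0, truncate_zero hL, zero_mul]
  · simp

/-- A station without green messages has a large corrected load only because of its own red queue,
so the red Lyapunov term can pay for it. -/
lemma truncate_greenLoad_mul_le {β γ : ℝ} (hβ1 : β ≤ 1) (hγ : 0 ≤ γ)
    (z : QState M) (j : Fin M) :
    truncate L (greenLoad β γ z j) * (if z.2 j = 0 then 1 else 0) ≤ truncate L (redLoad z j) := by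
  split_ifs with hj
  · rw [mul_one]
    refine truncate_mono ?_
    have hM := one_le_cast (M := M)
    have h1 : (0 : ℝ) ≤ z.1 j := by positivity
    have h2 : 0 ≤ γ * ∑ i, (z.1 i : ℝ) := by positivity
    have h3 : (0 : ℝ) ≤ ((j : ℕ) : ℝ) := by positivity
    have h4 : β * z.1 j ≤ M * z.1 j := mul_le_mul_of_nonneg_right (hβ1.trans hM) h1
    rw [greenLoad, redLoad, hj]
    push_cast
    linarith
  · rw [mul_zero]; exact truncate_nonneg _ _

lemma SlotLaw.integral_lyapunov_le (h : SlotLaw ν p lamR lamG) (hp0 : 0 ≤ p) (hp1 : p ≤ 1)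
    (hR : lamR < 1) (hL : 0 ≤ L) {β γ δ : ℝ} (hβ : β = p * (1 - p) ^ (M - 2))
    (hγ : γ = p * (1 - p) ^ (M - 2) - p * (1 - p) ^ (M - 1))
    (hδ : δ = (lamR * (M - 1) * p * (1 - p) ^ (M - 2) + (1 - lamR) * M * p * (1 - p) ^ (M - 1)
      - lamG) / M) (z : QState M) :
    Integrable (fun n => lyapunov L β γ (2 / (1 - lamR)) (relabelledStep z n)) ν ∧
    ∫ n, lyapunov L β γ (2 / (1 - lamR)) (relabelledStep z n) ∂ν
      ≤ lyapunov L β γ (2 / (1 - lamR)) z - δ * ∑ j, truncate L (greenLoad β γ z j)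
        - ∑ j, truncate L (redLoad z j)
        + M * (1 + 2 / (1 - lamR)) * ∫ n, min (incrBound n) L * incrBound n ∂ν := by
  have hq0 : 0 ≤ 1 - p := by linarith
  have hq1 : 1 - p ≤ 1 := by linarith
  have hβ0 : 0 ≤ β := by rw [hβ]; positivity
  have hβ1 : β ≤ 1 := by rw [hβ]; exact mul_le_one₀ hp1 (by positivity) (pow_le_one₀ hq0 hq1)
  have hα0 : 0 ≤ p * (1 - p) ^ (M - 1) := by positivity
  have hγ0 : 0 ≤ γ := by
    rw [hγ, sub_nonneg]
    exact mul_le_mul_of_nonneg_left (pow_le_pow_of_le_one hq0 hq1 (by omega)) hp0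
  have hγ1 : γ ≤ 1 := by rw [hγ, ← hβ]; linarith
  set c := 2 / (1 - lamR) with hc
  have hc0 : 0 ≤ c := div_nonneg zero_le_two (by linarith)
  -- One unit of this red drift cancels the term from empty green queues, and the other remains as
  -- the net drift.
  have hcR : c * (lamR - 1) = -2 := by
    rw [hc]; field_simp [show (1 - lamR) ≠ 0 by linarith]; ring
  set e := ∫ n, min (incrBound n) L * incrBound n ∂ν
  have hH := h.integrable_incrBound
  have hGi : ∀ j, Integrable
      (fun n => huber L (greenLoad β γ z j + greenIncr β γ z j n)) ν := fun j =>
    integrable_huber hL (h.integrable_greenIncr β γ z j) _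
  have hRi : ∀ j, Integrable (fun n => huber L (redLoad z j + redIncr z j n)) ν := fun j =>
    integrable_huber hL (h.integrable_redIncr z j) _
  have hG : ∀ j, ∫ n, huber L (greenLoad β γ z j + greenIncr β γ z j n) ∂ν
      ≤ huber L (greenLoad β γ z j) - δ * truncate L (greenLoad β γ z j)
        + truncate L (redLoad z j) + e := fun j => by
    have h1 := integral_huber_le hL (h.integrable_greenIncr β γ z j) hH
      (abs_greenIncr_le hβ0 hβ1 hγ0 hγ1 z j) (greenLoad β γ z j)
    have h2 := h.integral_greenIncr_le hp0 hp1 z j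
    rw [← hγ, ← hβ, ← hδ] at h2
    have h3 := mul_le_mul_of_nonneg_left h2 (truncate_nonneg L (greenLoad β γ z j))
    have h4 := truncate_greenLoad_mul_le (L := L) hβ1 hγ0 z j
    rw [mul_add] at h3
    linarith
  have hRd : ∀ j, ∫ n, huber L (redLoad z j + redIncr z j n) ∂ν
      ≤ huber L (redLoad z j) + (lamR - 1) * truncate L (redLoad z j) + e := fun j => by
    have h1 := integral_huber_le hL (h.integrable_redIncr z j) hH
      (abs_redIncr_le z j) (redLoad z j)
    rw [h.integral_redIncr, mul_add, truncate_redLoad_mul hL] at h1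
    linarith
  simp_rw [lyapunov_step]
  have hGs := integrable_finsetSum Finset.univ fun j _ => hGi j
  have hRs := (integrable_finsetSum Finset.univ fun j _ => hRi j).const_mul c
  refine ⟨hGs.add hRs, ?_⟩
  rw [integral_add hGs hRs, integral_const_mul, integral_finsetSum _ fun j _ => hGi j,
    integral_finsetSum _ fun j _ => hRi j]
  have h5 := Finset.sum_le_sum fun j (_ : j ∈ Finset.univ) => hG j
  have h6 := mul_le_mul_of_nonneg_left
    (Finset.sum_le_sum fun j (_ : j ∈ Finset.univ) => hRd j) hc0
  simp only [Finset.sum_add_distrib, Finset.sum_sub_distrib, ← Finset.mul_sum, Finset.sum_const,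
    Finset.card_univ, Fintype.card_fin, nsmul_eq_mul] at h5 h6
  rw [mul_add, mul_add, ← mul_assoc c (lamR - 1), hcR] at h6
  rw [lyapunov]
  linarith

/-- The red loads bound the red queues first; the negative correction in `greenLoad` is then at most
`γ * (M * L)`. -/
lemma finite_load_le {β γ : ℝ} (hβ : 0 ≤ β) (hγ : 0 ≤ γ) (L : ℝ) :
    {z : QState M | ∀ k, redLoad z k ≤ L ∧ greenLoad β γ z k ≤ L}.Finite := by
  set B : ℕ := ⌈L + γ * (M * L)⌉₊ + ⌈L⌉₊ with hB
  refine ((Set.finite_Icc (0 : Fin M → ℕ) fun _ => B).prod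
    (Set.finite_Icc (0 : Fin M → ℕ) fun _ => B)).subset fun z hz => ?_
  have hM := one_le_cast (M := M)
  have hR : ∀ k, (z.1 k : ℝ) ≤ L := fun k => by
    have h1 := (hz k).1
    rw [redLoad] at h1
    have h2 : (z.1 k : ℝ) ≤ M * z.1 k := le_mul_of_one_le_left (by positivity) hM
    have h3 : (0 : ℝ) ≤ ((k : ℕ) : ℝ) := by positivity
    linarith
  have hG : ∀ k, (z.2 k : ℝ) ≤ L + γ * (M * L) := fun k => by
    have h1 := (hz k).2
    rw [greenLoad] at h1
    have h2 : ∑ j, (z.1 j : ℝ) ≤ M * L := by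
      calc ∑ j, (z.1 j : ℝ) ≤ ∑ _j : Fin M, L := Finset.sum_le_sum fun j _ => hR j
        _ = M * L := by simp
    have h3 := mul_le_mul_of_nonneg_left h2 hγ
    have h4 : 0 ≤ β * z.1 k := by positivity
    linarith
  refine ⟨⟨fun k => Nat.zero_le _, fun k => ?_⟩, fun k => Nat.zero_le _, fun k => ?_⟩
  · have h1 : (z.1 k : ℝ) ≤ (⌈L⌉₊ : ℕ) := (hR k).trans (Nat.le_ceil _)
    have h2 : z.1 k ≤ ⌈L⌉₊ := by exact_mod_cast h1
    exact h2.trans (Nat.le_add_left _ _)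
  · have h1 : (z.2 k : ℝ) ≤ (⌈L + γ * (M * L)⌉₊ : ℕ) := (hG k).trans (Nat.le_ceil _)
    have h2 : z.2 k ≤ ⌈L + γ * (M * L)⌉₊ := by exact_mod_cast h1
    exact h2.trans (Nat.le_add_right _ _)

lemma le_sum_truncate_of_notMem (hL : 0 ≤ L) {β γ δ : ℝ} (hδ : 0 < δ) {z : QState M}
    (hz : z ∉ {z : QState M | ∀ k, redLoad z k ≤ L ∧ greenLoad β γ z k ≤ L}) :
    min δ 1 * L ≤ δ * ∑ j, truncate L (greenLoad β γ z j) + ∑ j, truncate L (redLoad z j) := by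
  have h1 : 0 ≤ ∑ j, truncate L (greenLoad β γ z j) :=
    Finset.sum_nonneg fun _ _ => truncate_nonneg _ _
  have h2 : 0 ≤ ∑ j, truncate L (redLoad z j) :=
    Finset.sum_nonneg fun _ _ => truncate_nonneg _ _
  simp only [Set.mem_ofPred_eq, not_forall] at hz
  obtain ⟨k, hk⟩ := hz
  rw [not_and_or, not_le, not_le] at hk
  rcases hk with hk | hk
  · have h3 : L ≤ ∑ j, truncate L (redLoad z j) := by
      rw [← truncate_of_le hL hk.le]
      exact Finset.single_le_sum (f := fun j => truncate _ (redLoad z j))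
        (fun _ _ => truncate_nonneg _ _) (Finset.mem_univ k) |>.trans
        (by rw [truncate_of_le hL hk.le])
    have h4 : min δ 1 * L ≤ 1 * L := mul_le_mul_of_nonneg_right (min_le_right _ _) hL
    have h5 := mul_nonneg hδ.le h1
    linarith
  · have h3 : L ≤ ∑ j, truncate L (greenLoad β γ z j) := by
      rw [← truncate_of_le hL hk.le]
      exact Finset.single_le_sum (f := fun j => truncate _ (greenLoad β γ z j))
        (fun _ _ => truncate_nonneg _ _) (Finset.mem_univ k) |>.trans
        (by rw [truncate_of_le hL hk.le])
    have h4 : min δ 1 * L ≤ δ * L := mul_le_mul_of_nonneg_right (min_le_left _ _) hL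
    have h5 := mul_le_mul_of_nonneg_left h3 hδ.le
    linarith

/-- Below the critical load the occupation measures of the relabelled process are tight. -/
theorem SlotLaw.cesaroTight (h : SlotLaw ν p lamR lamG) (hp0 : 0 ≤ p) (hp1 : p ≤ 1)
    (hR : lamR < 1) (hG : lamG < lamR * (M - 1) * p * (1 - p) ^ (M - 2)
      + (1 - lamR) * M * p * (1 - p) ^ (M - 1)) : CesaroTight (slotKernel ν) := by
  have hM := one_le_cast (M := M)
  have hq0 : 0 ≤ 1 - p := by linarith
  have hq1 : 1 - p ≤ 1 := by linarith
  obtain ⟨β, hβ⟩ : ∃ β, β = p * (1 - p) ^ (M - 2) := ⟨_, rfl⟩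
  obtain ⟨γ, hγ⟩ : ∃ γ, γ = p * (1 - p) ^ (M - 2) - p * (1 - p) ^ (M - 1) := ⟨_, rfl⟩
  obtain ⟨δ, hδ⟩ : ∃ δ, δ = (lamR * (M - 1) * p * (1 - p) ^ (M - 2)
    + (1 - lamR) * M * p * (1 - p) ^ (M - 1) - lamG) / M := ⟨_, rfl⟩
  have hβ0 : 0 ≤ β := by rw [hβ]; positivity
  have hγ0 : 0 ≤ γ := by
    rw [hγ, sub_nonneg]
    exact mul_le_mul_of_nonneg_left (pow_le_pow_of_le_one hq0 hq1 (by omega)) hp0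
  have hδ0 : 0 < δ := by rw [hδ]; exact div_pos (by linarith) (by linarith)
  have hd0 : 0 < min δ 1 := lt_min hδ0 one_pos
  set c := 2 / (1 - lamR) with hc
  have hc0 : 0 ≤ c := div_nonneg zero_le_two (by linarith)
  refine cesaroTight_of_drift fun ε hε => ?_
  have ht := (tendsto_integral_min_mul_div (ν := ν) h.integrable_incrBound
    incrBound_nonneg).const_mul (M * (1 + c) / min δ 1)
  rw [mul_zero] at ht
  -- The truncation level is `L = N`. Dividing the Lyapunov function by `min δ 1 * N` makes the drop
  -- outside the finite set at least `1`, up to an error below `ε`.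
  obtain ⟨N, hN, hN1⟩ := ((ht.eventually (gt_mem_nhds hε)).and (eventually_ge_atTop 1)).exists
  have hL1 : (1 : ℝ) ≤ N := by exact_mod_cast hN1
  have hL0 : (0 : ℝ) ≤ N := by linarith
  have hs : 0 < min δ 1 * N := mul_pos hd0 (by linarith)
  refine ⟨{z | ∀ k, redLoad z k ≤ N ∧ greenLoad β γ z k ≤ N},
    fun z => ENNReal.ofReal (lyapunov N β γ c z / (min δ 1 * N)), finite_load_le hβ0 hγ0 _,
    fun z => ENNReal.ofReal_ne_top, fun z => ?_⟩
  obtain ⟨hint, hle⟩ := h.integral_lyapunov_le hp0 hp1 hR hL0 hβ hγ hδ z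
  rw [← hc] at hint hle
  have hnn : ∀ z : QState M, 0 ≤ lyapunov N β γ c z / (min δ 1 * N) := fun z =>
    div_nonneg (lyapunov_nonneg hL0 β γ hc0 z) hs.le
  rw [slotKernel_apply, lintegral_map (measurable_of_countable _) (measurable_of_countable _),
    ← ofReal_integral_eq_lintegral_ofReal (hint.div_const _)
      (Eventually.of_forall fun n => hnn _), integral_div]
  set F : Set (QState M) := {z | ∀ k, redLoad z k ≤ N ∧ greenLoad β γ z k ≤ N} with hF
  have hind : Fᶜ.indicator (1 : QState M → ℝ≥0∞) z
      = ENNReal.ofReal (Fᶜ.indicator (1 : QState M → ℝ) z) := by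
    by_cases hz : z ∈ Fᶜ <;> simp [hz]
  have hind0 : 0 ≤ Fᶜ.indicator (1 : QState M → ℝ) z :=
    Set.indicator_nonneg (fun _ _ => zero_le_one) _
  beta_reduce
  rw [hind, ← ENNReal.ofReal_add
      (div_nonneg (integral_nonneg fun n => lyapunov_nonneg hL0 β γ hc0 (relabelledStep z n)) hs.le)
      hind0,
    ← ENNReal.ofReal_add (hnn z) hε.le]
  refine ENNReal.ofReal_le_ofReal ?_
  have h7 : min δ 1 * N * Fᶜ.indicator (1 : QState M → ℝ) z
      ≤ δ * ∑ j, truncate N (greenLoad β γ z j) + ∑ j, truncate N (redLoad z j) := by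
    by_cases hz : z ∈ F
    · rw [Set.indicator_of_notMem (by simpa using hz), mul_zero]
      exact add_nonneg (mul_nonneg hδ0.le (Finset.sum_nonneg fun _ _ => truncate_nonneg _ _))
        (Finset.sum_nonneg fun _ _ => truncate_nonneg _ _)
    · rw [Set.indicator_of_mem (by simpa using hz), Pi.one_apply, mul_one]
      exact le_sum_truncate_of_notMem hL0 hδ0 hz
  have h8 : M * (1 + c) * ∫ n, min (incrBound n) N * incrBound n ∂ν ≤ ε * (min δ 1 * N) := by
    rw [← div_le_iff₀ hs]
    refine le_trans (le_of_eq ?_) hN.le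
    rw [div_mul_div_comm]
  rw [← le_sub_iff_add_le, div_le_iff₀ hs, sub_mul, add_mul,
    div_mul_cancel₀ _ hs.ne']
  linarith

end SlotTight

/-! ### Law of the inputs of a slot -/

section Law

variable {M : ℕ} {Ω : Type*}

/-- The sources of randomness within one slot. -/
inductive SlotSource (M : ℕ) where
  | red
  | green
  | redNode (k : ℕ)
  | greenNode (k : ℕ)
  | coin (i : Fin M)

/-- The source in slot `t`, with the stations relabelled by `σ`. -/
def SlotSource.toSource (t : ℕ) (σ : Equiv.Perm (Fin M)) : SlotSource M → Source M
  | .red => .red t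
  | .green => .green t
  | .redNode k => .redNode t k
  | .greenNode k => .greenNode t k
  | .coin i => .coin t (σ i)

lemma SlotSource.toSource_injective (t : ℕ) (σ : Equiv.Perm (Fin M)) :
    Function.Injective (SlotSource.toSource t σ) := by
  intro a b hab
  cases a <;> cases b <;> simp_all [SlotSource.toSource]

/-- The slot to which a source belongs. -/
def Source.time : Source M → ℕ
  | .red t => t
  | .green t => t
  | .redNode t _ => t
  | .greenNode t _ => t
  | .coin t _ => t

lemma SlotSource.time_toSource (t : ℕ) (σ : Equiv.Perm (Fin M)) (s : SlotSource M) :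
    (s.toSource t σ).time = t := by
  cases s <;> rfl

/-- The values of the sources of slot `t`, coded by natural numbers, with the stations relabelled
by `σ`. -/
def codedInput (I : Inputs M Ω) (t : ℕ) (σ : Equiv.Perm (Fin M)) : SlotSource M → Ω → ℕ
  | .red, ω => I.red t ω
  | .green, ω => I.green t ω
  | .redNode k, ω => (σ.symm (I.redNode t k ω) : Fin M)
  | .greenNode k, ω => (σ.symm (I.greenNode t k ω) : Fin M)
  | .coin i, ω => (I.coin t (σ i) ω).toNat

/-- The slot input that is coded by `y`. -/
def decodeInput (y : SlotSource M → ℕ) : SlotInput M :=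
  (fun i => decide (y (.coin i) = 1),
   fun i => ((Finset.range (y .red)).filter fun k => y (.redNode k) = (i : ℕ)).card,
   fun i => ((Finset.range (y .green)).filter fun k => y (.greenNode k) = (i : ℕ)).card)

/-- The inputs of slot `t`, with the stations relabelled by `σ`. -/
def slotInput (I : Inputs M Ω) (t : ℕ) (σ : Equiv.Perm (Fin M)) (ω : Ω) : SlotInput M :=
  (fun i => I.coin t (σ i) ω, fun i => I.redAt t (σ i) ω, fun i => I.greenAt t (σ i) ω)

lemma slotInput_eq_decodeInput (I : Inputs M Ω) (t : ℕ) (σ : Equiv.Perm (Fin M)) (ω : Ω) :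
    slotInput I t σ ω = decodeInput fun s => codedInput I t σ s ω := by
  have hv : ∀ a i : Fin M, ((σ.symm a : Fin M) : ℕ) = i ↔ a = σ i := fun a i => by
    rw [Fin.val_inj, Equiv.symm_apply_eq]
  unfold slotInput decodeInput
  refine Prod.ext ?_ (Prod.ext ?_ ?_)
  · funext i
    cases h : I.coin t (σ i) ω <;> simp [codedInput, h]
  · funext i
    simp only [codedInput, Inputs.redAt, hv]
  · funext i
    simp only [codedInput, Inputs.greenAt, hv]

/-- The range of summation is random; freezing its value `n`, of which there are countably many,
leaves a finite sum. -/
lemma measurable_card_filter {α : Type*} [MeasurableSpace α] {N : α → ℕ} (hN : Measurable N)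
    {X : ℕ → α → ℕ} (hX : ∀ k, Measurable (X k)) (i : ℕ) :
    Measurable fun a => ((Finset.range (N a)).filter fun k => X k a = i).card := by
  have h : Measurable fun q : ℕ × α =>
      ((Finset.range q.1).filter fun k => X k q.2 = i).card := by
    refine measurable_from_prod_countable_right fun n => ?_
    simp_rw [Finset.card_filter]
    refine Finset.measurable_sum _ fun k _ => ?_
    exact Measurable.ite (hX k (measurableSet_singleton i)) measurable_const measurable_const
  exact h.comp (hN.prodMk measurable_id)

lemma measurable_decodeInput : Measurable (decodeInput (M := M)) := by
  refine Measurable.prodMk (measurable_pi_lambda _ fun i => ?_)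
    (Measurable.prodMk (measurable_pi_lambda _ fun i => ?_) (measurable_pi_lambda _ fun i => ?_))
  · exact (measurable_from_top (f := fun n : ℕ => decide (n = 1))).comp (measurable_pi_apply _)
  · exact measurable_card_filter (measurable_pi_apply _) (fun k => measurable_pi_apply _) i
  · exact measurable_card_filter (measurable_pi_apply _) (fun k => measurable_pi_apply _) i

lemma measurable_slotInput [MeasurableSpace Ω] {I : Inputs M Ω} {t : ℕ}
    {σ : Equiv.Perm (Fin M)} (h : ∀ s, Measurable (codedInput I t σ s)) :
    Measurable (slotInput I t σ) := by
  have h1 : slotInput I t σ = decodeInput ∘ fun ω s => codedInput I t σ s ω :=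
    funext fun ω => slotInput_eq_decodeInput I t σ ω
  rw [h1]
  exact measurable_decodeInput.comp (measurable_pi_lambda _ h)

lemma measurable_codedInput_sigma (I : Inputs M Ω) (t : ℕ) (σ : Equiv.Perm (Fin M))
    (s : SlotSource M) : Measurable[I.sigma (s.toSource t σ)] (codedInput I t σ s) := by
  cases s with
  | red => exact comap_measurable (m := ⊤) (I.red t)
  | green => exact comap_measurable (m := ⊤) (I.green t)
  | redNode k =>
    exact (measurable_from_top (f := fun a : Fin M => ((σ.symm a : Fin M) : ℕ))).comp
      (comap_measurable (m := ⊤) (I.redNode t k))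
  | greenNode k =>
    exact (measurable_from_top (f := fun a : Fin M => ((σ.symm a : Fin M) : ℕ))).comp
      (comap_measurable (m := ⊤) (I.greenNode t k))
  | coin i =>
    exact (measurable_from_top (f := Bool.toNat)).comp
      (comap_measurable (m := ⊤) (I.coin t (σ i)))

variable [MeasurableSpace Ω] {I : Inputs M Ω} {μ : Measure Ω} [IsProbabilityMeasure μ]
  {lamR lamG p : ℝ}

namespace Inputs.Satisfies

variable (hI : I.Satisfies μ lamR lamG p)

include hI

lemma sigma_le (s : Source M) : I.sigma s ≤ ‹MeasurableSpace Ω› := by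
  cases s with
  | red t => exact (hI.measurable_red t).comap_le
  | green t => exact (hI.measurable_green t).comap_le
  | redNode t k => exact (hI.measurable_redNode t k).comap_le
  | greenNode t k => exact (hI.measurable_greenNode t k).comap_le
  | coin t i => exact (hI.measurable_coin t i).comap_le

lemma measurable_codedInput (t : ℕ) (σ : Equiv.Perm (Fin M)) (s : SlotSource M) :
    Measurable (codedInput I t σ s) :=
  (measurable_codedInput_sigma I t σ s).mono (hI.sigma_le _) le_rfl

lemma measurable_slotInput (t : ℕ) (σ : Equiv.Perm (Fin M)) : Measurable (slotInput I t σ) :=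
  _root_.measurable_slotInput (hI.measurable_codedInput t σ)

lemma iIndepFun_codedInput (t : ℕ) (σ : Equiv.Perm (Fin M)) :
    iIndepFun (codedInput I t σ) μ := by
  rw [iIndepFun_iff_iIndep]
  exact iIndep_of_iIndep_of_le (hI.indep.precomp (SlotSource.toSource_injective t σ))
    fun s => (measurable_codedInput_sigma I t σ s).comap_le

lemma measure_coin_false (t : ℕ) (i : Fin M) :
    μ {ω | I.coin t i ω = false} = 1 - ENNReal.ofReal p := by
  have h1 : {ω | I.coin t i ω = false} = {ω | I.coin t i ω = true}ᶜ := by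
    ext ω; simp
  have h2 : MeasurableSet {ω | I.coin t i ω = true} :=
    hI.measurable_coin t i (measurableSet_singleton true)
  rw [h1, prob_compl_eq_one_sub h2, hI.coin_prob]

/-- The uniform law is invariant under permutations and all coins have the same bias, so relabelling
preserves each marginal. -/
lemma map_codedInput (t : ℕ) (σ : Equiv.Perm (Fin M)) (s : SlotSource M) :
    μ.map (codedInput I t σ s) = μ.map (codedInput I 0 1 s) := by
  have hnode : ∀ (X : ℕ → Ω → Fin M) (_ : ∀ t i, μ {ω | X t ω = i} = (M : ENNReal)⁻¹)
      (t : ℕ) (σ : Equiv.Perm (Fin M)) (n : ℕ),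
      μ {ω | ((σ.symm (X t ω) : Fin M) : ℕ) = n} = if n < M then (M : ENNReal)⁻¹ else 0 := by
    intro X hX t σ n
    split_ifs with hn
    · rw [← hX t (σ ⟨n, hn⟩)]
      congr 1
      ext ω
      simp only [Set.mem_ofPred_eq]
      rw [← Equiv.symm_apply_eq, Fin.ext_iff]
    · rw [show {ω | ((σ.symm (X t ω) : Fin M) : ℕ) = n} = ∅ from
        Set.eq_empty_of_forall_notMem fun ω hω => hn (hω ▸ (σ.symm (X t ω)).2), measure_empty]
  cases s with
  | red => exact (hI.identDistrib_red t).map_eq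
  | green => exact (hI.identDistrib_green t).map_eq
  | redNode k =>
    refine Measure.ext_of_singleton fun n => ?_
    rw [Measure.map_apply (hI.measurable_codedInput _ _ _) (measurableSet_singleton n),
      Measure.map_apply (hI.measurable_codedInput _ _ _) (measurableSet_singleton n)]
    exact (hnode (fun t => I.redNode t k) (fun t i => hI.redNode_uniform t k i) t σ n).trans
      (hnode (fun t => I.redNode t k) (fun t i => hI.redNode_uniform t k i) 0 1 n).symm
  | greenNode k =>
    refine Measure.ext_of_singleton fun n => ?_
    rw [Measure.map_apply (hI.measurable_codedInput _ _ _) (measurableSet_singleton n),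
      Measure.map_apply (hI.measurable_codedInput _ _ _) (measurableSet_singleton n)]
    exact (hnode (fun t => I.greenNode t k) (fun t i => hI.greenNode_uniform t k i) t σ n).trans
      (hnode (fun t => I.greenNode t k) (fun t i => hI.greenNode_uniform t k i) 0 1 n).symm
  | coin i =>
    have h1 : μ.map (I.coin t (σ i)) = μ.map (I.coin 0 i) := by
      refine Measure.ext_of_singleton fun b => ?_
      rw [Measure.map_apply (hI.measurable_coin _ _) (measurableSet_singleton b),
        Measure.map_apply (hI.measurable_coin _ _) (measurableSet_singleton b)]
      cases b
      · exact (hI.measure_coin_false t (σ i)).trans (hI.measure_coin_false 0 i).symm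
      · exact (hI.coin_prob t (σ i)).trans (hI.coin_prob 0 i).symm
    have h2 : ∀ t (σ : Equiv.Perm (Fin M)), μ.map (codedInput I t σ (.coin i))
        = (μ.map (I.coin t (σ i))).map Bool.toNat := fun t σ => by
      rw [Measure.map_map (measurable_of_countable _) (hI.measurable_coin _ _)]
      rfl
    rw [h2, h2, h1]
    rfl

/-- The law of the inputs of a slot depends neither on the slot nor on the labels of the
stations. -/
lemma map_slotInput (t : ℕ) (σ : Equiv.Perm (Fin M)) :
    μ.map (slotInput I t σ) = μ.map (slotInput I 0 1) := by
  have h1 : ∀ t σ, μ.map (slotInput I t σ)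
      = (μ.map fun ω s => codedInput I t σ s ω).map decodeInput := fun t σ => by
    rw [Measure.map_map measurable_decodeInput
      (measurable_pi_lambda _ (hI.measurable_codedInput t σ))]
    congr 1
    exact funext fun ω => slotInput_eq_decodeInput I t σ ω
  -- By independence the joint law is the product of its marginals, so equality of marginals
  -- suffices.
  rw [h1, h1, (hI.iIndepFun_codedInput t σ).map_fun_eq_infinitePi_map (hI.measurable_codedInput t σ),
    (hI.iIndepFun_codedInput 0 1).map_fun_eq_infinitePi_map (hI.measurable_codedInput 0 1)]
  simp_rw [hI.map_codedInput t σ]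

end Inputs.Satisfies

end Law

/-! ### Markov property and moments of the relabelled process -/

section Markov

variable {M : ℕ} {Ω : Type*} [MeasurableSpace Ω] {I : Inputs M Ω} {μ : Measure Ω}
  [IsProbabilityMeasure μ] {lamR lamG p : ℝ}

lemma Inputs.sum_redAt (I : Inputs M Ω) (t : ℕ) (ω : Ω) : ∑ i, I.redAt t i ω = I.red t ω := by
  simp_rw [Inputs.redAt]
  rw [← Finset.card_eq_sum_card_fiberwise (fun _ _ => Finset.mem_univ _), Finset.card_range]

lemma Inputs.sum_greenAt (I : Inputs M Ω) (t : ℕ) (ω : Ω) :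
    ∑ i, I.greenAt t i ω = I.green t ω := by
  simp_rw [Inputs.greenAt]
  rw [← Finset.card_eq_sum_card_fiberwise (fun _ _ => Finset.mem_univ _), Finset.card_range]

variable [NeZero M]

/-- The station scheduled `k` slots after `t`, as a permutation of the stations. -/
def stationPerm (M : ℕ) [NeZero M] (t : ℕ) : Equiv.Perm (Fin M) := Equiv.addLeft (scheduled M t)

lemma scheduled_add (t : ℕ) (k : Fin M) : scheduled M (t + k) = stationPerm M t k := by
  refine Fin.ext ?_
  simp only [scheduled, stationPerm, Equiv.coe_addLeft, Fin.val_add, Fin.val_ofNat]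
  rw [Nat.mod_add_mod]
  congr 1
  omega

lemma stationPerm_zero_apply (t : ℕ) : stationPerm M t 0 = scheduled M t := by
  simp [stationPerm]

lemma stationPerm_succ_apply (t : ℕ) (k : Fin M) :
    stationPerm M (t + 1) k = stationPerm M t (k + 1) := by
  have h : scheduled M (t + 1) = scheduled M t + 1 := by
    refine Fin.ext ?_
    simp only [scheduled, Fin.val_add, Fin.val_ofNat, Fin.val_one']
    rw [Nat.add_mod_mod, Nat.mod_add_mod]
    congr 1
    omega
  simp only [stationPerm, Equiv.coe_addLeft, h]
  rw [add_assoc, add_comm 1 k]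

lemma relabel_eq (t : ℕ) (z : QState M) :
    relabel t z = (z.1 ∘ stationPerm M t, z.2 ∘ stationPerm M t) := by
  refine Prod.ext (funext fun k => ?_) (funext fun k => ?_) <;>
    simp [relabel, scheduled_add]

lemma succeeds_comp_iff (σ : Equiv.Perm (Fin M)) (s : Fin M) (z : QState M) (c : Fin M → Bool)
    (i : Fin M) : Succeeds s (z.1 ∘ σ, z.2 ∘ σ) (c ∘ σ) i ↔ Succeeds (σ s) z c (σ i) := by
  simp only [Succeeds, Attempts, Function.comp_apply, EmbeddingLike.apply_eq_iff_eq]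
  refine and_congr_right fun _ => ⟨fun h j hj => ?_, fun h j hj => ?_⟩
  · have h1 := h (σ.symm j) (fun h2 => hj (by rw [← h2, Equiv.apply_symm_apply]))
    rw [Equiv.apply_symm_apply, Equiv.symm_apply_eq] at h1
    exact h1
  · have h1 := h (σ j) (fun h2 => hj (σ.injective h2))
    rw [EmbeddingLike.apply_eq_iff_eq] at h1
    exact h1

/-- In the moving labels station `0` is always the scheduled one, so the update map no longer
depends on `t`. -/
lemma relabel_queues_succ (I : Inputs M Ω) (z : QState M) (t : ℕ) (ω : Ω) :
    relabel (t + 1) (queues I z (t + 1) ω)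
      = relabelledStep (relabel t (queues I z t ω)) (slotInput I t (stationPerm M t) ω) := by
  have hs := succeeds_comp_iff (stationPerm M t) 0 (queues I z t ω) (fun i => I.coin t i ω)
  rw [relabel_eq, relabel_eq]
  refine Prod.ext (funext fun k => ?_) (funext fun k => ?_)
  · simp only [relabelledStep, slotStep, queues, slotInput, Function.comp_apply,
      stationPerm_succ_apply, ← stationPerm_zero_apply (M := M) t, EmbeddingLike.apply_eq_iff_eq]
  · have h1 : Succeeds 0 ((queues I z t ω).1 ∘ stationPerm M t, (queues I z t ω).2 ∘ stationPerm M t)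
        (fun i => I.coin t (stationPerm M t i) ω) (k + 1)
        ↔ Succeeds (scheduled M t) (queues I z t ω) (fun i => I.coin t i ω)
          (stationPerm M (t + 1) k) := by
      rw [stationPerm_succ_apply, ← stationPerm_zero_apply]
      exact hs (k + 1)
    simp only [relabelledStep, slotStep, queues, slotInput, Function.comp_apply]
    refine congrArg₂ (· + ·) (congrArg₂ (· - ·) ?_ ?_) ?_
    · rw [stationPerm_succ_apply]
    · by_cases hk : Succeeds (scheduled M t) (queues I z t ω) (fun i => I.coin t i ω)
          (stationPerm M (t + 1) k)
      · exact (if_pos hk).trans (if_pos (h1.mpr hk)).symm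
      · exact (if_neg hk).trans (if_neg fun h => hk (h1.mp h)).symm
    · rw [stationPerm_succ_apply]

/-- The law of the slot inputs. -/
noncomputable def slotMeasure (I : Inputs M Ω) (μ : Measure Ω) : Measure (SlotInput M) :=
  μ.map (slotInput I 0 1)

namespace Inputs.Satisfies

variable (hI : I.Satisfies μ lamR lamG p)

include hI

lemma isProbabilityMeasure_slotMeasure : IsProbabilityMeasure (slotMeasure I μ) :=
  Measure.isProbabilityMeasure_map (hI.measurable_slotInput 0 1).aemeasurable

lemma measurable_relabel_queues (z : QState M) (t : ℕ) :
    Measurable[⨆ s ∈ {s : Source M | s.time < t}, I.sigma s]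
      fun ω => relabel t (queues I z t ω) := by
  induction t with
  | zero =>
    exact @measurable_const _ _ _ (_) (relabel 0 z)
  | succ t ih =>
    simp_rw [relabel_queues_succ]
    have h1 : Measurable[⨆ s ∈ {s : Source M | s.time < t + 1}, I.sigma s]
        fun ω => relabel t (queues I z t ω) :=
      ih.mono (biSup_mono fun s (hs : s.time < t) => hs.trans (Nat.lt_succ_self t)) le_rfl
    have h2 : Measurable[⨆ s ∈ {s : Source M | s.time < t + 1}, I.sigma s]
        (slotInput I t (stationPerm M t)) := by
      refine @_root_.measurable_slotInput M Ω (_) _ _ _ fun s => ?_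
      refine (measurable_codedInput_sigma I t _ s).mono ?_ le_rfl
      exact le_iSup₂_of_le (f := fun s (_ : s ∈ {s : Source M | s.time < t + 1}) => I.sigma s)
        (s.toSource t _) (by simp [SlotSource.time_toSource]) le_rfl
    exact (measurable_of_countable fun q : QState M × SlotInput M =>
      relabelledStep q.1 q.2).comp (h1.prodMk h2)

/-- The relabelled process is a Markov chain. -/
theorem isMarkovChain (z : QState M) :
    IsMarkovChain μ (fun t ω => relabel t (queues I z t ω)) (slotKernel (slotMeasure I μ)) := by
  have hle : ∀ S : Set (Source M), ⨆ s ∈ S, I.sigma s ≤ ‹MeasurableSpace Ω› := fun S =>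
    iSup₂_le fun s _ => hI.sigma_le s
  refine ⟨fun t => (hI.measurable_relabel_queues z t).mono (hle _) le_rfl, fun t x => ?_⟩
  set B : Set (SlotInput M) := relabelledStep (x t) ⁻¹' {x (t + 1)} with hB
  have hBm : MeasurableSet B := (Set.to_countable _).measurableSet
  have hsplit : {ω | ∀ k ≤ t + 1, relabel k (queues I z k ω) = x k}
      = {ω | ∀ k ≤ t, relabel k (queues I z k ω) = x k}
        ∩ slotInput I t (stationPerm M t) ⁻¹' B := by
    ext ω
    constructor
    · intro hω
      refine ⟨fun k hk => hω k (hk.trans (Nat.le_succ t)), ?_⟩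
      have h1 := hω (t + 1) le_rfl
      rw [relabel_queues_succ, hω t (Nat.le_succ t)] at h1
      exact h1
    · rintro ⟨h1, h2⟩ k hk
      rcases hk.lt_or_eq with hk | rfl
      · exact h1 k (Nat.lt_succ_iff.mp hk)
      · rw [relabel_queues_succ, h1 t le_rfl]
        exact h2
  have hpast : MeasurableSet[⨆ s ∈ {s : Source M | s.time < t}, I.sigma s]
      {ω | ∀ k ≤ t, relabel k (queues I z k ω) = x k} := by
    have h1 : {ω | ∀ k ≤ t, relabel k (queues I z k ω) = x k}
        = ⋂ k ∈ Finset.Iic t, (fun ω => relabel k (queues I z k ω)) ⁻¹' {x k} := by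
      ext ω; simp
    rw [h1]
    refine @Finset.measurableSet_biInter _ _ (_) _ _ fun k hk => ?_
    have h2 : Measurable[⨆ s ∈ {s : Source M | s.time < t}, I.sigma s]
        fun ω => relabel k (queues I z k ω) :=
      (hI.measurable_relabel_queues z k).mono
        (biSup_mono fun s (hs : s.time < k) => hs.trans_le (Finset.mem_Iic.mp hk)) le_rfl
    exact h2 (measurableSet_singleton _)
  have hpres : MeasurableSet[⨆ s ∈ {s : Source M | s.time = t}, I.sigma s]
      (slotInput I t (stationPerm M t) ⁻¹' B) := by
    have h2 : Measurable[⨆ s ∈ {s : Source M | s.time = t}, I.sigma s]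
        (slotInput I t (stationPerm M t)) := by
      refine @_root_.measurable_slotInput M Ω (_) _ _ _ fun s => ?_
      refine (measurable_codedInput_sigma I t _ s).mono ?_ le_rfl
      exact le_iSup₂_of_le (f := fun s (_ : s ∈ {s : Source M | s.time = t}) => I.sigma s)
        (s.toSource t _) (SlotSource.time_toSource t _ s) le_rfl
    exact h2 hBm
  -- The history up to time `t` uses only sources of earlier slots, and the next step only those of
  -- slot `t`; disjoint families of sources are independent.
  have hdisj : Disjoint {s : Source M | s.time < t} {s : Source M | s.time = t} :=
    Set.disjoint_left.mpr fun s (h1 : s.time < t) (h2 : s.time = t) => h1.ne h2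
  rw [hsplit, (Indep_iff _ _ _).mp (indep_iSup_of_disjoint hI.sigma_le hI.indep hdisj) _ _
    hpast hpres]
  congr 1
  rw [slotKernel_apply, Measure.map_apply (measurable_of_countable _) (measurableSet_singleton _),
    slotMeasure, ← hI.map_slotInput t (stationPerm M t),
    Measure.map_apply (hI.measurable_slotInput _ _) hBm]

lemma integrable_redAt (k : Fin M) : Integrable (fun ω => (I.redAt 0 k ω : ℝ)) μ := by
  refine hI.integrable_red.mono' ?_ (Eventually.of_forall fun ω => ?_)
  · have h1 : Measurable fun ω => (slotInput I 0 1 ω).2.1 k :=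
      (measurable_of_countable fun n : SlotInput M => n.2.1 k).comp (hI.measurable_slotInput 0 1)
    exact ((measurable_of_countable fun n : ℕ => (n : ℝ)).comp h1).aestronglyMeasurable
  · rw [Real.norm_of_nonneg (by positivity), ← I.sum_redAt]
    exact_mod_cast Finset.single_le_sum (f := fun i => I.redAt 0 i ω) (fun i _ => Nat.zero_le _)
      (Finset.mem_univ k)

lemma integrable_greenAt (k : Fin M) : Integrable (fun ω => (I.greenAt 0 k ω : ℝ)) μ := by
  refine hI.integrable_green.mono' ?_ (Eventually.of_forall fun ω => ?_)
  · have h1 : Measurable fun ω => (slotInput I 0 1 ω).2.2 k :=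
      (measurable_of_countable fun n : SlotInput M => n.2.2 k).comp (hI.measurable_slotInput 0 1)
    exact ((measurable_of_countable fun n : ℕ => (n : ℝ)).comp h1).aestronglyMeasurable
  · rw [Real.norm_of_nonneg (by positivity), ← I.sum_greenAt]
    exact_mod_cast Finset.single_le_sum (f := fun i => I.greenAt 0 i ω) (fun i _ => Nat.zero_le _)
      (Finset.mem_univ k)

lemma integral_slotInput (f : SlotInput M → ℝ) (σ : Equiv.Perm (Fin M)) :
    ∫ ω, f (slotInput I 0 σ ω) ∂μ = ∫ n, f n ∂(slotMeasure I μ) := by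
  rw [slotMeasure, ← hI.map_slotInput 0 σ, integral_map
    (hI.measurable_slotInput 0 σ).aemeasurable (measurable_of_countable _).aestronglyMeasurable]

/-- Exchangeability: swapping two stations preserves the slot law, so the `M` means agree, and they
add up to `lamR`. -/
lemma integral_redAt (k : Fin M) : ∫ ω, (I.redAt 0 k ω : ℝ) ∂μ = lamR / M := by
  have h1 : ∀ j, ∫ ω, (I.redAt 0 j ω : ℝ) ∂μ = ∫ ω, (I.redAt 0 k ω : ℝ) ∂μ := fun j => by
    have h2 := (hI.integral_slotInput (fun n => (n.2.1 k : ℝ)) (Equiv.swap k j)).trans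
      (hI.integral_slotInput (fun n => (n.2.1 k : ℝ)) 1).symm
    simpa [slotInput] using h2
  have h3 : ∑ j, ∫ ω, (I.redAt 0 j ω : ℝ) ∂μ = lamR := by
    rw [← integral_finsetSum _ fun j _ => hI.integrable_redAt j, ← hI.mean_red]
    refine integral_congr_ae (Eventually.of_forall fun ω => ?_)
    dsimp only
    rw [← I.sum_redAt 0 ω]
    push_cast
    rfl
  simp_rw [h1] at h3
  have hM := one_le_cast (M := M)
  rw [eq_div_iff (by linarith), ← h3]
  simp [mul_comm]

lemma integral_greenAt (k : Fin M) : ∫ ω, (I.greenAt 0 k ω : ℝ) ∂μ = lamG / M := by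
  have h1 : ∀ j, ∫ ω, (I.greenAt 0 j ω : ℝ) ∂μ = ∫ ω, (I.greenAt 0 k ω : ℝ) ∂μ := fun j => by
    have h2 := (hI.integral_slotInput (fun n => (n.2.2 k : ℝ)) (Equiv.swap k j)).trans
      (hI.integral_slotInput (fun n => (n.2.2 k : ℝ)) 1).symm
    simpa [slotInput] using h2
  have h3 : ∑ j, ∫ ω, (I.greenAt 0 j ω : ℝ) ∂μ = lamG := by
    rw [← integral_finsetSum _ fun j _ => hI.integrable_greenAt j, ← hI.mean_green]
    refine integral_congr_ae (Eventually.of_forall fun ω => ?_)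
    dsimp only
    rw [← I.sum_greenAt 0 ω]
    push_cast
    rfl
  simp_rw [h1] at h3
  have hM := one_le_cast (M := M)
  rw [eq_div_iff (by linarith), ← h3]
  simp [mul_comm]

lemma slotLaw (hp0 : 0 ≤ p) (hp1 : p ≤ 1) : SlotLaw (slotMeasure I μ) p lamR lamG where
  integrable_red k := by
    rw [slotMeasure, integrable_map_measure (measurable_of_countable _).aestronglyMeasurable
      (hI.measurable_slotInput 0 1).aemeasurable]
    exact hI.integrable_redAt k
  integrable_green k := by
    rw [slotMeasure, integrable_map_measure (measurable_of_countable _).aestronglyMeasurable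
      (hI.measurable_slotInput 0 1).aemeasurable]
    exact hI.integrable_greenAt k
  mean_red k := by
    rw [← hI.integral_slotInput (fun n => (n.2.1 k : ℝ)) 1]
    exact hI.integral_redAt k
  mean_green k := by
    rw [← hI.integral_slotInput (fun n => (n.2.2 k : ℝ)) 1]
    exact hI.integral_greenAt k
  coin k T hk := by
    have hinj : Function.Injective fun i : Fin M => Source.coin (M := M) 0 i := fun a b hab => by
      simpa using hab
    have h1 := (hI.indep.precomp hinj).meas_biInter (S := insert k T)
      (s := fun i => {ω | I.coin 0 i ω = decide (i = k)}) fun i _ =>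
        ⟨{decide (i = k)}, trivial, rfl⟩
    have h2 : slotInput I 0 1 ⁻¹' {n | n.1 k = true ∧ ∀ j ∈ T, n.1 j = false}
        = ⋂ i ∈ insert k T, {ω | I.coin 0 i ω = decide (i = k)} := by
      ext ω
      simp only [slotInput, Set.mem_preimage, Set.mem_ofPred_eq, Set.mem_iInter,
        Finset.forall_mem_insert, Equiv.Perm.coe_one, id_eq, decide_true]
      refine and_congr_right fun _ => forall₂_congr fun j hj => ?_
      have hjk : j ≠ k := fun h => hk (h ▸ hj)
      simp [hjk]
    have h3 : ∀ j ∈ T, μ {ω | I.coin 0 j ω = decide (j = k)} = 1 - ENNReal.ofReal p :=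
      fun j hj => by
        have hjk : j ≠ k := fun h => hk (h ▸ hj)
        simp only [hjk, decide_false]
        exact hI.measure_coin_false 0 j
    rw [Measure.real, slotMeasure, Measure.map_apply (hI.measurable_slotInput 0 1)
      (Set.to_countable _).measurableSet, h2, h1, Finset.prod_insert hk, Finset.prod_congr rfl h3]
    simp only [decide_true, hI.coin_prob, Finset.prod_const, ENNReal.toReal_mul,
      ENNReal.toReal_pow, ENNReal.toReal_ofReal hp0]
    rw [ENNReal.toReal_sub_of_le (by simpa using hp1) (by simp), ENNReal.toReal_ofReal hp0,
      ENNReal.toReal_one]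

end Inputs.Satisfies

end Markov

/-! ### Accessibility of the empty state -/

section Accessibility

/-- The state `y` can be reached from the state `x`. -/
def Accessible {S : Type*} [MeasurableSpace S] (K : Kernel S S) (x y : S) : Prop :=
  ∃ n, 0 < (K ^ n) x {y}

lemma Accessible.trans {S : Type*} [MeasurableSpace S] [Countable S] [MeasurableSingletonClass S]
    {K : Kernel S S} {x y z : S} (h1 : Accessible K x y) (h2 : Accessible K y z) :
    Accessible K x z := by
  obtain ⟨m, hm⟩ := h1
  obtain ⟨n, hn⟩ := h2
  exact ⟨m + n, (ENNReal.mul_pos hm.ne' hn.ne').trans_le (mul_le_pow_add m n x y {z})⟩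

lemma Accessible.refl {S : Type*} [MeasurableSpace S] [MeasurableSingletonClass S]
    (K : Kernel S S) (x : S) : Accessible K x x := by
  refine ⟨0, ?_⟩
  have h : (K ^ 0) x = Measure.dirac x := by
    rw [pow_zero]; exact Kernel.id_apply x
  rw [h]
  simp

variable {M : ℕ} [NeZero M] {ν : Measure (SlotInput M)}

lemma slotKernel_pos {n : SlotInput M} (hn : 0 < ν {n}) (z : QState M) :
    0 < slotKernel ν z {relabelledStep z n} := by
  rw [slotKernel_apply, Measure.map_apply (measurable_of_countable _) (measurableSet_singleton _)]
  exact hn.trans_le (measure_mono (by simp))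

lemma accessible_relabelledStep {n : SlotInput M} (hn : 0 < ν {n}) (z : QState M) :
    Accessible (slotKernel ν) z (relabelledStep z n) :=
  ⟨1, by rw [pow_one]; exact slotKernel_pos hn z⟩

lemma sum_red_step_le (z : QState M) (c : Fin M → Bool) :
    ∑ k, (relabelledStep z (c, 0, 0)).1 k ≤ ∑ k, z.1 k := by
  rw [← sum_add_one z.1]
  exact Finset.sum_le_sum fun k _ => by simp [relabelledStep, slotStep]

lemma sum_red_step_lt {z : QState M} (hz : 0 < z.1 0) (c : Fin M → Bool) :
    ∑ k, (relabelledStep z (c, 0, 0)).1 k < ∑ k, z.1 k := by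
  rw [← sum_add_one z.1]
  -- The strict decrease is at new position `-1`, where the station just served, formerly at `0`,
  -- ends up.
  refine Finset.sum_lt_sum (fun k _ => by simp [relabelledStep, slotStep])
    ⟨-1, Finset.mem_univ _, ?_⟩
  simp only [relabelledStep, slotStep, neg_add_cancel]
  simp [hz]

lemma sum_green_step_le (z : QState M) (c : Fin M → Bool) (a : Fin M → ℕ) :
    ∑ k, (relabelledStep z (c, a, 0)).2 k ≤ ∑ k, z.2 k := by
  rw [← sum_add_one z.2]
  exact Finset.sum_le_sum fun k _ => by simp [relabelledStep, slotStep]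

lemma sum_green_step_lt {z : QState M} {c : Fin M → Bool} {j : Fin M}
    (hj : Succeeds 0 z c j) (a : Fin M → ℕ) :
    ∑ k, (relabelledStep z (c, a, 0)).2 k < ∑ k, z.2 k := by
  rw [← sum_add_one z.2]
  refine Finset.sum_lt_sum (fun k _ => by simp [relabelledStep, slotStep])
    ⟨j - 1, Finset.mem_univ _, ?_⟩
  have h0 : 0 < z.2 j := hj.1.1
  simp only [relabelledStep, slotStep, sub_add_cancel]
  simp [hj, h0]

/-- Without arrivals, a station at position `m` reaches the front after `m` slots and then sends a
red message. -/
lemma exists_accessible_red_lt {c : Fin M → Bool} (hc : 0 < ν {(c, 0, 0)}) (m : ℕ) :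
    ∀ (z : QState M) (k : Fin M), (k : ℕ) = m → 0 < z.1 k →
      ∃ z', Accessible (slotKernel ν) z z' ∧ ∑ k, z'.1 k < ∑ k, z.1 k
        ∧ ∑ k, z'.2 k ≤ ∑ k, z.2 k := by
  induction m with
  | zero =>
    intro z k hk hz
    have hk0 : k = 0 := Fin.ext (by simpa using hk)
    subst hk0
    exact ⟨_, accessible_relabelledStep hc z, sum_red_step_lt hz c, sum_green_step_le z c 0⟩
  | succ m ih =>
    intro z k hk hz
    have hm : m < M := by have := k.2; omega
    have hk1 : (⟨m, hm⟩ : Fin M) + 1 = k := by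
      refine Fin.ext ?_
      rw [Fin.val_add, Fin.val_one', Nat.add_mod_mod]
      exact (Nat.mod_eq_of_lt (hk ▸ k.2)).trans hk.symm
    have hk0 : k ≠ 0 := fun h => by rw [h] at hk; simp at hk
    obtain ⟨z', h1, h2, h3⟩ := ih (relabelledStep z (c, 0, 0)) ⟨m, hm⟩ rfl (by
      simp only [relabelledStep, slotStep, hk1]
      simpa [hk0] using hz)
    exact ⟨z', (accessible_relabelledStep hc z).trans h1, h2.trans_le (sum_red_step_le z c),
      h3.trans (sum_green_step_le z c 0)⟩

lemma exists_accessible_red_eq_zero {c : Fin M → Bool} (hc : 0 < ν {(c, 0, 0)}) (z : QState M) :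
    ∃ z', Accessible (slotKernel ν) z z' ∧ z'.1 = 0 ∧ ∑ k, z'.2 k ≤ ∑ k, z.2 k := by
  induction hN : ∑ k, z.1 k using Nat.strong_induction_on generalizing z with
  | _ N ih =>
    by_cases hz : z.1 = 0
    · exact ⟨z, Accessible.refl _ z, hz, le_rfl⟩
    · obtain ⟨k, hk⟩ := Function.ne_iff.mp hz
      obtain ⟨z', h1, h2, h3⟩ := exists_accessible_red_lt hc k z k rfl (Nat.pos_of_ne_zero hk)
      obtain ⟨w, h4, h5, h6⟩ := ih _ (hN ▸ h2) z' rfl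
      exact ⟨w, h1.trans h4, h5, h6.trans h3⟩

lemma accessible_zero {c : Fin M → Bool} (hc : 0 < ν {(c, 0, 0)})
    (hgreen : ∀ z : QState M, z.1 = 0 → z.2 ≠ 0 →
      ∃ z', Accessible (slotKernel ν) z z' ∧ ∑ k, z'.2 k < ∑ k, z.2 k) (z : QState M) :
    Accessible (slotKernel ν) z 0 := by
  induction hN : ∑ k, z.2 k using Nat.strong_induction_on generalizing z with
  | _ N ih =>
    obtain ⟨w, h1, h2, h3⟩ := exists_accessible_red_eq_zero hc z
    by_cases hw : w.2 = 0
    · have : w = 0 := Prod.ext h2 hw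
      exact this ▸ h1
    · obtain ⟨v, h4, h5⟩ := hgreen w h2 hw
      exact (h1.trans h4).trans (ih _ (hN ▸ h5.trans_le h3) v rfl)

lemma slotKernel_zero_pos {c : Fin M → Bool} (hc : 0 < ν {(c, 0, 0)}) :
    0 < slotKernel ν (0 : QState M) {0} := by
  have h : relabelledStep (0 : QState M) (c, 0, 0) = 0 := by
    refine Prod.ext (funext fun k => ?_) (funext fun k => ?_) <;>
      simp [relabelledStep, slotStep]
  have h1 := slotKernel_pos hc (0 : QState M)
  rwa [h] at h1

lemma exists_accessible_green_lt_of_single (hc : ∀ c : Fin M → Bool, 0 < ν {(c, 0, 0)})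
    {z : QState M} (hz : z.1 = 0) (hz2 : z.2 ≠ 0) :
    ∃ z', Accessible (slotKernel ν) z z' ∧ ∑ k, z'.2 k < ∑ k, z.2 k := by
  obtain ⟨k, hk⟩ := Function.ne_iff.mp hz2
  refine ⟨_, accessible_relabelledStep (hc fun j => decide (j = k)) z,
    sum_green_step_lt (j := k) ⟨⟨Nat.pos_of_ne_zero hk, by simp, by simp [hz]⟩, ?_⟩ 0⟩
  rintro j hj ⟨-, h2, -⟩
  simp [hj] at h2

/-- The case where every station always attempts. A lone green queue succeeds at once; two of them
collide until a red arrival occupies one station. -/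
lemma exists_accessible_green_lt_of_true (hc : 0 < ν {(fun _ => true, 0, 0)}) (hM : M ≤ 2)
    (hred : M = 2 → ∃ m : ℕ, 0 < m ∧ 0 < ν {(fun _ => true, Pi.single 1 m, 0)})
    {z : QState M} (hz : z.1 = 0) (hz2 : z.2 ≠ 0) :
    ∃ z', Accessible (slotKernel ν) z z' ∧ ∑ k, z'.2 k < ∑ k, z.2 k := by
  obtain ⟨k, hk⟩ := Function.ne_iff.mp hz2
  have hk0 : 0 < z.2 k := Nat.pos_of_ne_zero hk
  by_cases hl : ∃ l, l ≠ k ∧ 0 < z.2 l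
  · obtain ⟨l, hlk, hl0⟩ := hl
    have hM2 : M = 2 := by
      have h1 := l.2
      have h2 := k.2
      have h3 : (l : ℕ) ≠ k := fun h => hlk (Fin.ext h)
      omega
    obtain ⟨m, hm0, hm⟩ := hred hM2
    have hall : ∀ j, 0 < z.2 j := fun j => by
      have h3 : (l : ℕ) ≠ k := fun h => hlk (Fin.ext h)
      have h4 : (j : ℕ) = l ∨ (j : ℕ) = k := by omega
      rcases h4 with h4 | h4
      · rw [Fin.ext h4]; exact hl0
      · rw [Fin.ext h4]; exact hk0
    have hatt : ∀ j, Attempts 0 z (fun _ => true) j := fun j => ⟨hall j, rfl, by simp [hz]⟩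
    have hno : ∀ j, ¬ Succeeds 0 z (fun _ => true) j := fun j hj => by
      by_cases hjk : j = k
      · exact hj.2 l (hjk ▸ hlk) (hatt l)
      · exact hj.2 k (Ne.symm hjk) (hatt k)
    have h1v : ((1 : Fin M) : ℕ) = 1 := by rw [Fin.val_one', hM2]
    have h10 : (1 : Fin M) ≠ 0 := fun h => by
      have h2 := congrArg Fin.val h
      rw [h1v] at h2
      simp at h2
    -- The green messages collide while red ones join the station that is scheduled next. In the
    -- following slot that station sends red, and the other attempts alone.
    set w := relabelledStep z (fun _ => true, Pi.single 1 m, 0) with hw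
    have hw1 : 0 < w.1 0 := by
      simp only [hw, relabelledStep, slotStep]
      simp [hm0]
    have hw2 : 0 < w.2 1 := by
      simp only [hw, relabelledStep, slotStep]
      simp [hno, hall]
    have hs : Succeeds 0 w (fun _ => true) 1 := by
      refine ⟨⟨hw2, rfl, fun h => h10 h.1⟩, fun j hj1 hj => ?_⟩
      have hj0 : j = 0 := by
        refine Fin.ext ?_
        have h5 : (j : ℕ) ≠ 1 := fun h => hj1 (Fin.ext (h.trans h1v.symm))
        have h6 := j.2
        simp only [Fin.coe_ofNat_eq_mod, Nat.zero_mod]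
        omega
      subst hj0
      exact hj.2.2 ⟨rfl, hw1⟩
    exact ⟨_, (accessible_relabelledStep hm z).trans (accessible_relabelledStep hc w),
      (sum_green_step_lt hs 0).trans_le (sum_green_step_le z _ _)⟩
  · push Not at hl
    refine ⟨_, accessible_relabelledStep hc z,
      sum_green_step_lt (j := k) ⟨⟨hk0, rfl, by simp [hz]⟩, fun j hj hja => ?_⟩ 0⟩
    exact absurd hja.1 (not_lt.mpr (hl j hj))

end Accessibility

/-! ### Positivity of the required inputs and conclusion -/

section Application

lemma measure_eq_zero_pos {Ω : Type*} [MeasurableSpace Ω] {μ : Measure Ω} [IsProbabilityMeasure μ]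
    {X : Ω → ℕ} (hX : Integrable (fun ω => (X ω : ℝ)) μ) (h : ∫ ω, (X ω : ℝ) ∂μ < 1) :
    0 < μ {ω | X ω = 0} := by
  by_contra h0
  have h1 : ∀ᵐ ω ∂μ, (1 : ℝ) ≤ X ω := by
    have h2 : ∀ᵐ ω ∂μ, ¬ X ω = 0 := by
      rw [ae_iff]
      simpa using h0
    filter_upwards [h2] with ω hω
    exact_mod_cast Nat.one_le_iff_ne_zero.mpr hω
  have h3 := integral_mono_ae (integrable_const (1 : ℝ)) hX h1
  simp only [integral_const, probReal_univ, one_smul] at h3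
  linarith

lemma exists_measure_eq_pos {Ω : Type*} [MeasurableSpace Ω] {μ : Measure Ω}
    {X : Ω → ℕ} (h : 0 < ∫ ω, (X ω : ℝ) ∂μ) : ∃ m, 0 < m ∧ 0 < μ {ω | X ω = m} := by
  by_contra! hm
  have h1 : ∀ᵐ ω ∂μ, ∀ m : ℕ, 0 < m → ¬ X ω = m := by
    rw [ae_all_iff]
    intro m
    by_cases h0 : 0 < m
    · simp only [h0, forall_const, ae_iff, not_not]
      exact le_antisymm (hm m h0) zero_le
    · simp [h0]
  have h2 : (fun ω => (X ω : ℝ)) =ᵐ[μ] 0 := by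
    filter_upwards [h1] with ω hω
    by_contra h3
    exact hω (X ω) (Nat.pos_of_ne_zero fun h4 => h3 (by simp [h4])) rfl
  rw [integral_congr_ae h2] at h
  simp at h

/-- The left side is the probability of exactly one success in `n` trials. Algebraically, `n * (1 -
p) ^ (n - 1)` is at most the geometric sum, and `p` times that sum is `1 - (1 - p) ^ n`. -/
lemma mul_mul_pow_le_one {p : ℝ} (hp0 : 0 ≤ p) (hp1 : p ≤ 1) (n : ℕ) :
    n * p * (1 - p) ^ (n - 1) ≤ 1 := by
  have hq0 : 0 ≤ 1 - p := by linarith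
  have h1 : (n : ℝ) * (1 - p) ^ (n - 1) ≤ ∑ i ∈ Finset.range n, (1 - p) ^ i := by
    calc (n : ℝ) * (1 - p) ^ (n - 1) = ∑ i ∈ Finset.range n, (1 - p) ^ (n - 1) := by simp
      _ ≤ _ := Finset.sum_le_sum fun i hi =>
        pow_le_pow_of_le_one hq0 (by linarith) (by have := Finset.mem_range.mp hi; omega)
  have h2 := geom_sum_mul (1 - p) n
  have h3 := mul_le_mul_of_nonneg_left h1 hp0
  have h4 : 0 ≤ (1 - p) ^ n := by positivity
  nlinarith

variable {M : ℕ} {Ω : Type*} [MeasurableSpace Ω] {I : Inputs M Ω} {μ : Measure Ω}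
  [IsProbabilityMeasure μ] {lamR lamG p : ℝ} [NeZero M]

-- The pattern involves only finitely many independent sources, namely two counts, the first `m` red
-- assignments and the coins, so its probability is at least a finite product of positive factors.
open Classical in
lemma Inputs.Satisfies.slotMeasure_pos (hI : I.Satisfies μ lamR lamG p) {m : ℕ} {i : Fin M}
    {c : Fin M → Bool} (hm : 0 < μ {ω | I.red 0 ω = m}) (h0 : 0 < μ {ω | I.green 0 ω = 0})
    (hc : ∀ j, 0 < μ {ω | I.coin 0 j ω = c j}) :
    0 < slotMeasure I μ {(c, Pi.single i m, 0)} := by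
  let f : SlotSource M → Set Ω := fun s => match s with
    | .red => {ω | I.red 0 ω = m}
    | .green => {ω | I.green 0 ω = 0}
    | .redNode k => {ω | I.redNode 0 k ω = i}
    | .greenNode _ => Set.univ
    | .coin j => {ω | I.coin 0 j ω = c j}
  let S : Finset (SlotSource M) := {.red, .green} ∪ (Finset.range m).image .redNode
    ∪ Finset.univ.image .coin
  have hmeas : ∀ s ∈ S, MeasurableSet[I.sigma (s.toSource 0 1)] (f s) := by
    intro s _
    cases s with
    | red => exact ⟨{m}, trivial, rfl⟩
    | green => exact ⟨{0}, trivial, rfl⟩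
    | redNode k => exact ⟨{i}, trivial, rfl⟩
    | greenNode k => exact ⟨Set.univ, trivial, rfl⟩
    | coin j => exact ⟨{c j}, trivial, rfl⟩
  have hpos : ∀ s, μ (f s) ≠ 0 := by
    intro s
    cases s with
    | red => exact hm.ne'
    | green => exact h0.ne'
    | redNode k =>
      change μ {ω | I.redNode 0 k ω = i} ≠ 0
      rw [hI.redNode_uniform]
      simp
    | greenNode k => simp [f]
    | coin j => exact (hc j).ne'
  have hprod := (hI.indep.precomp (SlotSource.toSource_injective 0 1)).meas_biInter hmeas
  have hsub : ⋂ s ∈ S, f s ⊆ slotInput I 0 1 ⁻¹' {(c, Pi.single i m, 0)} := by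
    intro ω hω
    rw [Set.mem_iInter₂] at hω
    have hr : I.red 0 ω = m := hω .red (by simp [S])
    have hg : I.green 0 ω = 0 := hω .green (by simp [S])
    have hn : ∀ k < m, I.redNode 0 k ω = i := fun k hk => hω (.redNode k) (by simp [S, hk])
    have hcoin : ∀ j, I.coin 0 j ω = c j := fun j => hω (.coin j) (by simp [S])
    rw [Set.mem_preimage, Set.mem_singleton_iff]
    refine Prod.ext (funext fun j => hcoin j) (Prod.ext (funext fun j => ?_) (funext fun j => ?_))
    · simp only [slotInput, Inputs.redAt, hr, Equiv.Perm.coe_one, id_eq]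
      by_cases hj : j = i
      · subst hj
        rw [Finset.filter_true_of_mem fun k hk => hn k (Finset.mem_range.mp hk)]
        simp
      · rw [Finset.filter_false_of_mem fun k hk h => hj
          (h.symm.trans (hn k (Finset.mem_range.mp hk)))]
        simp [hj]
    · simp [slotInput, Inputs.greenAt, hg]
  rw [slotMeasure, Measure.map_apply (hI.measurable_slotInput 0 1) (measurableSet_singleton _)]
  refine lt_of_lt_of_le ?_ (measure_mono hsub)
  rw [hprod]
  exact pos_iff_ne_zero.mpr (Finset.prod_ne_zero_iff.mpr fun s _ => hpos s)

/-- Below the critical load the empty state is accessible from every state and has a positive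
holding probability. -/
lemma Inputs.Satisfies.accessible_zero (hI : I.Satisfies μ lamR lamG p) (hp0 : 0 ≤ p) (hp1 : p ≤ 1)
    (hR : lamR < 1) (hG : lamG < lamR * (M - 1) * p * (1 - p) ^ (M - 2)
      + (1 - lamR) * M * p * (1 - p) ^ (M - 1)) :
    0 < slotKernel (slotMeasure I μ) (0 : QState M) {0} ∧
      ∀ z, Accessible (slotKernel (slotMeasure I μ)) z 0 := by
  have hM1 : 1 ≤ M := NeZero.one_le
  have hR0 : 0 ≤ lamR := by
    rw [← hI.mean_red]; exact integral_nonneg fun ω => by positivity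
  have hG0 : 0 ≤ lamG := by
    rw [← hI.mean_green]; exact integral_nonneg fun ω => by positivity
  -- The capacity is a convex combination of two probabilities of a single success, with `M - 1` and
  -- `M` contenders. Hence a slot without green arrivals has positive probability.
  have hG1 : lamG < 1 := by
    have h1 := mul_mul_pow_le_one hp0 hp1 M
    have h2 := mul_mul_pow_le_one hp0 hp1 (M - 1)
    rw [Nat.cast_sub hM1, Nat.cast_one, Nat.sub_sub] at h2
    have h3 := mul_le_mul_of_nonneg_left h1 (sub_nonneg.mpr hR.le)
    have h4 := mul_le_mul_of_nonneg_left h2 hR0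
    linarith
  have hp : 0 < p := by
    refine lt_of_le_of_ne hp0 fun h => ?_
    rw [← h] at hG
    simp only [mul_zero, zero_mul, add_zero] at hG
    linarith
  have hred0 : 0 < μ {ω | I.red 0 ω = 0} :=
    measure_eq_zero_pos hI.integrable_red (by rw [hI.mean_red]; exact hR)
  have hgreen0 : 0 < μ {ω | I.green 0 ω = 0} :=
    measure_eq_zero_pos hI.integrable_green (by rw [hI.mean_green]; exact hG1)
  have htrue : ∀ j, 0 < μ {ω | I.coin 0 j ω = true} := fun j => by
    rw [hI.coin_prob]; exact ENNReal.ofReal_pos.mpr hp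
  have hnone : ∀ c : Fin M → Bool, (∀ j, 0 < μ {ω | I.coin 0 j ω = c j}) →
      0 < slotMeasure I μ {(c, 0, 0)} := fun c hc => by
    have h1 := hI.slotMeasure_pos (i := 0) hred0 hgreen0 hc
    rwa [Pi.single_zero] at h1
  have hc := hnone (fun _ => true) htrue
  refine ⟨slotKernel_zero_pos hc, _root_.accessible_zero hc fun z hz hz2 => ?_⟩
  -- For `p < 1` every coin pattern is possible, so one station can be singled out. For `p = 1` the
  -- load condition forces `M ≤ 2`, and `lamR > 0` when `M = 2`.
  rcases hp1.lt_or_eq with hp1 | rfl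
  · refine exists_accessible_green_lt_of_single (fun c => hnone c fun j => ?_) hz hz2
    cases c j
    · rw [hI.measure_coin_false, tsub_pos_iff_lt]
      simpa using hp1
    · exact htrue j
  · have hM2 : M ≤ 2 := by
      by_contra hM
      rw [sub_self, zero_pow (by omega), zero_pow (by omega)] at hG
      linarith
    refine exists_accessible_green_lt_of_true hc hM2 (fun hM => ?_) hz hz2
    have hRpos : 0 < lamR := by
      refine lt_of_le_of_ne hR0 fun h => ?_
      rw [← h, sub_self, zero_pow (by omega : M - 1 ≠ 0)] at hG
      simp only [zero_mul, mul_zero, add_zero] at hG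
      linarith
    obtain ⟨m, hm0, hm⟩ := exists_measure_eq_pos (X := I.red 0) (μ := μ)
      (by rw [hI.mean_red]; exact hRpos)
    exact ⟨m, hm0, hI.slotMeasure_pos hm hgreen0 htrue⟩

end Application

theorem mainTheorem5 {Ω : Type*} [MeasurableSpace Ω] (μ : Measure Ω) [IsProbabilityMeasure μ]
    (M : ℕ) [NeZero M] (p lamR lamG : ℝ) (hp0 : 0 ≤ p) (hp1 : p ≤ 1)
    (I : Inputs M Ω) (hI : I.Satisfies μ lamR lamG p)
    (hR : lamR < 1)
    (hG1 : M = 1 → lamG < (1 - lamR) * p)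
    (hG2 : 1 < M → lamG < lamR * ((M : ℝ) - 1) * p * (1 - p) ^ (M - 2)
      + (1 - lamR) * (M : ℝ) * p * (1 - p) ^ (M - 1)) :
    ∃ K : Kernel (QState M) (QState M), IsMarkovKernel K ∧
      (∀ z : QState M, IsMarkovChain μ (fun t ω => relabel t (queues I z t ω)) K) ∧
      IsHarrisErgodic K := by
  -- The general formula also covers `M = 1`: the factor `M - 1` vanishes and the truncated
  -- exponents are `0`.
  have hG : lamG < lamR * (M - 1) * p * (1 - p) ^ (M - 2)
      + (1 - lamR) * M * p * (1 - p) ^ (M - 1) := by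
    rcases (NeZero.one_le : 1 ≤ M).lt_or_eq with hM | hM
    · exact hG2 hM
    · refine (hG1 hM.symm).trans_eq ?_
      subst hM
      simp
  have := hI.isProbabilityMeasure_slotMeasure
  obtain ⟨hloop, hacc⟩ := hI.accessible_zero hp0 hp1 hR hG
  exact ⟨slotKernel (slotMeasure I μ), inferInstance, hI.isMarkovChain,
    isHarrisErgodic_of_cesaroTight hloop hacc ((hI.slotLaw hp0 hp1).cesaroTight hp0 hp1 hR hG)⟩
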